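/- Let $0<k<n-1$, $l=n-k$, and let $u(t)=\|u_{ij}(t)\|$ be an $l\times k$ matrix whose entries are real polynomials in $t\in\mathbb R^k$. Write points of $\mathbb R^n=\mathbb R^k\oplus\mathbb R^l$ as $(x,y)$. All integrals over $\mathbb R^m$ are taken with respect to the normalized Lebesgue measure $(2\pi)^{-m/2}\,dx_1\cdots dx_m$ (and products of such measures). For a row vector $\xi\in\mathbb R^l$ put $$\omega(\xi,t)=\det\frac{\partial(\xi u(t))}{\partial t},\qquad \mathrm{Cr}_K(\eta,\xi)=\#\{t\in\mathbb R^k:\ \eta=-\xi u(t)\}\quad(\eta\in\mathbb R^k,\ \xi\in\mathbb R^l),$$ where $\mathrm{Cr}_K$ is the Crofton function of the family $K$ of $k$-planes $y=u(t)x+\alpha$, $(\alpha,t)\in\mathbb R^l\times\mathbb R^k$. Assume that $\mathrm{Cr}_K(\eta,\xi)$ is finite and nonzero for almost every $(\eta,\xi)$. Let $a(s,t)$ be a tempered generalized function on $\mathbb R^l\times\mathbb R^k$ whose Fourier transform $\widetilde a(\xi,t)=\int a(s,t)e^{i\langle s,\xi\rangle}\,ds$ with respect to $s$ is a usual (locally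 integrable) function, and let $$(J_af)(\alpha,t)=\int f(x,y)\,a(y-u(t)x-\alpha,t)\,dx\,dy .$$ If $$|\widetilde a(\xi,t)|=\mathrm{Cr}_K(-\xi u(t),\xi)^{-1/2}\,|\omega(\xi,t)|^{1/2}\qquad\text{for almost every }(\xi,t),$$ then $J_a$ is a generalized Fourier transform with kernel $e\bigl((x,y),(\alpha,t)\bigr)=a(y-u(t)x-\alpha,t)$. That is, $J_a$ (defined weakly on Schwartz functions) extends to a bounded operator $L^2(\mathbb R^k\times\mathbb R^l)\to L^2(\mathbb R^l\times\mathbb R^k)$; the Plancherel formula $$\int f\,\overline g\,dx\,dy=\int (J_af)\,\overline{(J_ag)}\,d\alpha\,dt$$ holds for all $f,g\in L^2$; and the inversion formula $$f(x,y)=\int (J_af)(\alpha,t)\,\overline{a(y-u(t)x-\alpha,t)}\,d\alpha\,dt$$ holds for all $f\in L^2$, in the sense that the integral operator with kernel $\overline{a(y-u(t)x-\alpha,t)}$ (defined weakly on Schwartz functions of $(\alpha,t)$) extends to a bounded operator $L^2(\mathbb R^l\times\mathbb R^k)\to L^2(\mathbb R^k\times\mathbb R^l)$ that is a left inverse of $J_a$.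 If moreover $\mathrm{Cr}_K=1$ almost everywhere, then $J_a$ maps $L^2(\mathbb R^k\times\mathbb R^l)$ onto $L^2(\mathbb R^l\times\mathbb R^k)$. -/

import Mathlib

open MeasureTheory Filter Topology
open scoped SchwartzMap ContDiff ComplexConjugate ENNReal NNReal

noncomputable section

/-! Operations on Schwartz functions -/

section Schwartz

variable {E F G : Type*} [NormedAddCommGroup E] [NormedSpace ℝ E]
  [NormedAddCommGroup F] [NormedSpace ℝ F] [NormedAddCommGroup G] [NormedSpace ℝ G]

/-- The pointwise complex conjugate of a Schwartz function. -/
def SchwartzMap.conjugate (f : 𝓢(E, ℂ)) : 𝓢(E, ℂ) :=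
  SchwartzMap.postcompCLM (𝕜 := ℝ) (Complex.conjCLE : ℂ →L[ℝ] ℂ) f

theorem SchwartzMap.conjugate_apply (f : 𝓢(E, ℂ)) (x : E) :
    f.conjugate x = conj (f x) := rfl

theorem SchwartzMap.tensor_decay (f : 𝓢(E, ℂ)) (g : 𝓢(F, ℂ)) (m n : ℕ) :
    ∃ C : ℝ, ∀ p : E × F,
      ‖p‖ ^ m * ‖iteratedFDeriv ℝ n (fun q : E × F => f q.1 * g q.2) p‖ ≤ C := by
  choose Cf hf using fun i : ℕ × ℕ => f.decay i.1 i.2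
  choose Cg hg using fun i : ℕ × ℕ => g.decay i.1 i.2
  refine ⟨∑ i ∈ Finset.range (n + 1), (n.choose i : ℝ) *
    (Cf (m, i) * Cg (0, n - i) + Cf (0, i) * Cg (m, n - i)), fun p => ?_⟩
  have h1 : ∀ i, ‖iteratedFDeriv ℝ i (fun q : E × F => f q.1) p‖
      ≤ ‖iteratedFDeriv ℝ i f p.1‖ := fun i => by
    have h := ContinuousLinearMap.iteratedFDeriv_comp_right (i := i)
      (ContinuousLinearMap.fst ℝ E F) (f.smooth i) p le_rfl
    change ‖iteratedFDeriv ℝ i (f ∘ ContinuousLinearMap.fst ℝ E F) p‖ ≤ _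
    rw [h]
    refine (ContinuousMultilinearMap.norm_compContinuousLinearMap_le _ _).trans ?_
    refine mul_le_of_le_one_right (norm_nonneg _) ?_
    exact Finset.prod_le_one (fun _ _ => norm_nonneg _)
      (fun _ _ => ContinuousLinearMap.norm_fst_le _ _ _)
  have h2 : ∀ i, ‖iteratedFDeriv ℝ i (fun q : E × F => g q.2) p‖
      ≤ ‖iteratedFDeriv ℝ i g p.2‖ := fun i => by
    have h := ContinuousLinearMap.iteratedFDeriv_comp_right (i := i)
      (ContinuousLinearMap.snd ℝ E F) (g.smooth i) p le_rfl
    change ‖iteratedFDeriv ℝ i (g ∘ ContinuousLinearMap.snd ℝ E F) p‖ ≤ _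
    rw [h]
    refine (ContinuousMultilinearMap.norm_compContinuousLinearMap_le _ _).trans ?_
    refine mul_le_of_le_one_right (norm_nonneg _) ?_
    exact Finset.prod_le_one (fun _ _ => norm_nonneg _)
      (fun _ _ => ContinuousLinearMap.norm_snd_le _ _ _)
  have hfs : ContDiff ℝ n (fun q : E × F => f q.1) := (f.smooth n).comp contDiff_fst
  have hgs : ContDiff ℝ n (fun q : E × F => g q.2) := (g.smooth n).comp contDiff_snd
  have hp : ‖p‖ ^ m ≤ ‖p.1‖ ^ m + ‖p.2‖ ^ m := by
    rcases max_cases ‖p.1‖ ‖p.2‖ with h | h <;> rw [Prod.norm_def, h.1]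
    · exact le_add_of_nonneg_right (by positivity)
    · exact le_add_of_nonneg_left (by positivity)
  calc _ ≤ (‖p.1‖ ^ m + ‖p.2‖ ^ m) * ∑ i ∈ Finset.range (n + 1), (n.choose i : ℝ) *
        ‖iteratedFDeriv ℝ i f p.1‖ * ‖iteratedFDeriv ℝ (n - i) g p.2‖ := by
        gcongr
        refine (norm_iteratedFDeriv_mul_le hfs hgs p le_rfl).trans ?_
        gcongr
        · exact h1 _
        · exact h2 _
    _ ≤ _ := by
        rw [Finset.mul_sum]
        refine Finset.sum_le_sum fun i _ => ?_
        have a1 := (hf (m, i)).2 p.1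
        have a2 := (hf (0, i)).2 p.1
        have b1 := (hg (m, n - i)).2 p.2
        have b2 := (hg (0, n - i)).2 p.2
        simp only [pow_zero, one_mul] at a2 b2
        calc _ = (n.choose i : ℝ) * ((‖p.1‖ ^ m * ‖iteratedFDeriv ℝ i f p.1‖) *
              ‖iteratedFDeriv ℝ (n - i) g p.2‖ + ‖iteratedFDeriv ℝ i f p.1‖ *
              (‖p.2‖ ^ m * ‖iteratedFDeriv ℝ (n - i) g p.2‖)) := by ring
          _ ≤ _ := by
              have := (norm_nonneg _).trans a2
              have : 0 ≤ Cf (m, i) := le_trans (by positivity) a1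
              gcongr

/-- The tensor product `(x, y) ↦ f x * g y` of two Schwartz functions. -/
def SchwartzMap.tensor (f : 𝓢(E, ℂ)) (g : 𝓢(F, ℂ)) : 𝓢(E × F, ℂ) where
  toFun p := f p.1 * g p.2
  smooth' := ((f.smooth ⊤).comp contDiff_fst).mul ((g.smooth ⊤).comp contDiff_snd)
  decay' := SchwartzMap.tensor_decay f g

theorem SchwartzMap.tensor_apply (f : 𝓢(E, ℂ)) (g : 𝓢(F, ℂ)) (p : E × F) :
    f.tensor g p = f p.1 * g p.2 := rfl

end Schwartz

/-! Integration of a Schwartz function over one of its variables -/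

section FiberIntegral

variable {E F G : Type} [NormedAddCommGroup E] [NormedSpace ℝ E]
  [NormedAddCommGroup F] [NormedSpace ℝ F] [NormedAddCommGroup G] [NormedSpace ℝ G]

/-- The partial derivative in the first variable. -/
def SchwartzMap.fstDeriv (f : 𝓢(E × F, G)) : 𝓢(E × F, E →L[ℝ] G) :=
  SchwartzMap.postcompCLM (𝕜 := ℝ)
    ((ContinuousLinearMap.compL ℝ E (E × F) G).flip (ContinuousLinearMap.inl ℝ E F))
    (SchwartzMap.fderivCLM ℝ (E × F) G f)

theorem SchwartzMap.fstDeriv_apply (f : 𝓢(E × F, G)) (p : E × F) :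
    f.fstDeriv p = (fderiv ℝ f p).comp (ContinuousLinearMap.inl ℝ E F) := rfl

theorem SchwartzMap.norm_iteratedFDeriv_fstDeriv_le (f : 𝓢(E × F, G)) (n : ℕ) (p : E × F) :
    ‖iteratedFDeriv ℝ n f.fstDeriv p‖ ≤ ‖iteratedFDeriv ℝ (n + 1) f p‖ := by
  set L := (ContinuousLinearMap.compL ℝ E (E × F) G).flip (ContinuousLinearMap.inl ℝ E F)
  have hsm : ContDiff ℝ n (fderiv ℝ f) := (f.smooth (n + 1 : ℕ)).fderiv_right (by norm_cast)
  have hLn : ‖L‖ ≤ 1 := by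
    refine ContinuousLinearMap.opNorm_le_bound _ zero_le_one fun T => ?_
    calc ‖T.comp (ContinuousLinearMap.inl ℝ E F)‖ ≤ ‖T‖ * ‖ContinuousLinearMap.inl ℝ E F‖ :=
          ContinuousLinearMap.opNorm_comp_le _ _
      _ ≤ ‖T‖ * 1 := by
          gcongr
          exact ContinuousLinearMap.norm_inl_le_one ℝ E F
      _ = 1 * ‖T‖ := by ring
  change ‖iteratedFDeriv ℝ n (L ∘ fderiv ℝ f) p‖ ≤ _
  refine (L.norm_iteratedFDeriv_comp_left hsm.contDiffAt le_rfl).trans ?_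
  rw [norm_iteratedFDeriv_fderiv]
  exact mul_le_of_le_one_left (norm_nonneg _) hLn

variable [MeasurableSpace F] [BorelSpace F] [SecondCountableTopology F]
  (μ : Measure F) [μ.HasTemperateGrowth]

theorem SchwartzMap.norm_le_integrable_bound (f : 𝓢(E × F, G)) (m : ℕ) {B : ℝ}
    (hB : ∀ p : E × F, (1 + ‖p‖) ^ (m + μ.integrablePower) * ‖f p‖ ≤ B) (s : E) (z : F) :
    ‖s‖ ^ m * ‖f (s, z)‖ ≤ (1 + ‖z‖) ^ (-(μ.integrablePower : ℝ)) * B := by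
  rw [Real.rpow_neg (by positivity), Real.rpow_natCast, ← div_eq_inv_mul,
    le_div_iff₀ (by positivity)]
  refine le_trans ?_ (hB (s, z))
  have h1 : ‖s‖ ≤ 1 + ‖((s, z) : E × F)‖ := by
    linarith [norm_fst_le ((s, z) : E × F)]
  have h2 : 1 + ‖z‖ ≤ 1 + ‖((s, z) : E × F)‖ := by
    linarith [norm_snd_le ((s, z) : E × F)]
  calc _ = ‖s‖ ^ m * (1 + ‖z‖) ^ μ.integrablePower * ‖f (s, z)‖ := by ring
    _ ≤ (1 + ‖((s, z) : E × F)‖) ^ m * (1 + ‖((s, z) : E × F)‖) ^ μ.integrablePower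
          * ‖f (s, z)‖ := by gcongr
    _ = _ := by rw [pow_add]

theorem SchwartzMap.exists_one_add_bound (f : 𝓢(E × F, G)) (m : ℕ) :
    ∃ B, ∀ p : E × F, (1 + ‖p‖) ^ m * ‖f p‖ ≤ B :=
  ⟨_, fun p => by
    simpa using SchwartzMap.one_add_le_sup_seminorm_apply (𝕜 := ℝ) (m := (m, 0))
      (k := m) (n := 0) le_rfl le_rfl f p⟩

theorem SchwartzMap.continuous_fiber (f : 𝓢(E × F, G)) (s : E) :
    Continuous fun z => f (s, z) :=
  f.continuous.comp (Continuous.prodMk_right s)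

theorem SchwartzMap.integrable_fiber (f : 𝓢(E × F, G)) (s : E) :
    Integrable (fun z => f (s, z)) μ := by
  obtain ⟨B, hB⟩ := f.exists_one_add_bound (0 + μ.integrablePower)
  refine ((Measure.integrable_pow_neg_integrablePower μ).mul_const B).mono'
    (f.continuous_fiber s).aestronglyMeasurable (Eventually.of_forall fun z => ?_)
  simpa using f.norm_le_integrable_bound μ 0 hB s z

theorem SchwartzMap.hasFDerivAt_integral_fiber (f : 𝓢(E × F, G)) (s : E) :
    HasFDerivAt (fun s => ∫ z, f (s, z) ∂μ) (∫ z, f.fstDeriv (s, z) ∂μ) s := by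
  obtain ⟨B, hB⟩ := f.fstDeriv.exists_one_add_bound (0 + μ.integrablePower)
  refine hasFDerivAt_integral_of_dominated_of_fderiv_le (𝕜 := ℝ) (s := Set.univ)
    (F' := fun s z => f.fstDeriv (s, z)) univ_mem
    (Eventually.of_forall fun s => (f.continuous_fiber s).aestronglyMeasurable)
    (f.integrable_fiber μ s) (f.fstDeriv.continuous_fiber s).aestronglyMeasurable
    (Eventually.of_forall fun z s _ => ?_)
    ((Measure.integrable_pow_neg_integrablePower μ).mul_const B)
    (Eventually.of_forall fun z s _ => ?_)
  · simpa using f.fstDeriv.norm_le_integrable_bound μ 0 hB s z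
  · exact (f.hasFDerivAt (s, z)).comp s (hasFDerivAt_prodMk_left s z)

theorem SchwartzMap.contDiff_integral_fiber (n : ℕ) :
    ∀ {G : Type} [NormedAddCommGroup G] [NormedSpace ℝ G] (f : 𝓢(E × F, G)),
      ContDiff ℝ n (fun s => ∫ z, f (s, z) ∂μ) := by
  induction n with
  | zero =>
    intro G _ _ f
    have : Differentiable ℝ (fun s => ∫ z, f (s, z) ∂μ) :=
      fun s => (f.hasFDerivAt_integral_fiber μ s).differentiableAt
    exact contDiff_zero.2 this.continuous
  | succ n ih =>
    intro G _ _ f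
    push_cast
    rw [contDiff_succ_iff_hasFDerivAt]
    exact ⟨_, ih f.fstDeriv, f.hasFDerivAt_integral_fiber μ⟩

theorem SchwartzMap.norm_iteratedFDeriv_integral_fiber_le (m : ℕ) (n : ℕ) :
    ∀ {G : Type} [NormedAddCommGroup G] [NormedSpace ℝ G] (f : 𝓢(E × F, G)) {B : ℝ}
      (_ : ∀ p : E × F, (1 + ‖p‖) ^ (m + μ.integrablePower) * ‖iteratedFDeriv ℝ n f p‖ ≤ B)
      (s : E), ‖s‖ ^ m * ‖iteratedFDeriv ℝ n (fun s => ∫ z, f (s, z) ∂μ) s‖ ≤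
        (∫ z, (1 + ‖z‖) ^ (-(μ.integrablePower : ℝ)) ∂μ) * B := by
  induction n with
  | zero =>
    intro G _ _ f B hB s
    simp only [norm_iteratedFDeriv_zero] at hB ⊢
    rw [← integral_mul_const]
    calc _ ≤ ‖s‖ ^ m * ∫ z, ‖f (s, z)‖ ∂μ := by
          gcongr
          exact norm_integral_le_integral_norm _
      _ = ∫ z, ‖s‖ ^ m * ‖f (s, z)‖ ∂μ := (integral_const_mul _ _).symm
      _ ≤ _ := integral_mono ((f.integrable_fiber μ s).norm.const_mul _)
          ((Measure.integrable_pow_neg_integrablePower μ).mul_const B)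
          (f.norm_le_integrable_bound μ m hB s)
  | succ n ih =>
    intro G _ _ f B hB s
    have h : fderiv ℝ (fun s => ∫ z, f (s, z) ∂μ) = fun s => ∫ z, f.fstDeriv (s, z) ∂μ :=
      funext fun s => (f.hasFDerivAt_integral_fiber μ s).fderiv
    rw [← norm_iteratedFDeriv_fderiv, h]
    refine ih f.fstDeriv (fun p => le_trans ?_ (hB p)) s
    gcongr
    exact f.norm_iteratedFDeriv_fstDeriv_le n p

/-- Integration over the second variable, `f ↦ (s ↦ ∫ z, f (s, z) ∂μ)`, as a continuous linear
map between Schwartz spaces. -/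
def SchwartzMap.fiberIntegral : 𝓢(E × F, ℂ) →L[ℂ] 𝓢(E, ℂ) :=
  SchwartzMap.mkCLM (fun f s => ∫ z, f (s, z) ∂μ)
    (fun f g s => integral_add (f.integrable_fiber μ s) (g.integrable_fiber μ s))
    (fun c f s => integral_const_mul c _)
    (fun f => contDiff_infty.2 fun n => SchwartzMap.contDiff_integral_fiber μ n f)
    (fun i => ⟨Finset.Iic (i.1 + μ.integrablePower, i.2),
      (∫ z, (1 + ‖z‖) ^ (-(μ.integrablePower : ℝ)) ∂μ) * 2 ^ (i.1 + μ.integrablePower),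
      by positivity, fun f s => by
        rw [mul_assoc]
        exact SchwartzMap.norm_iteratedFDeriv_integral_fiber_le μ i.1 i.2 f
          (fun p => SchwartzMap.one_add_le_sup_seminorm_apply (𝕜 := ℂ)
            (m := (i.1 + μ.integrablePower, i.2)) le_rfl le_rfl f p) s⟩)

theorem SchwartzMap.fiberIntegral_apply (f : 𝓢(E × F, ℂ)) (s : E) :
    SchwartzMap.fiberIntegral μ f s = ∫ z, f (s, z) ∂μ := rfl

end FiberIntegral

/-! Generalized Fourier transforms -/

section GFT

variable {X Y : Type*} [NormedAddCommGroup X] [NormedSpace ℝ X] [MeasurableSpace X] [BorelSpace X]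
  [SecondCountableTopology X] [NormedAddCommGroup Y] [NormedSpace ℝ Y] [MeasurableSpace Y]
  [BorelSpace Y] [SecondCountableTopology Y]

/-- The operator `T : L²(X, μ) → L²(Y, ν)` is the integral transform
`(T f)(y) = ∫ f(x) e(x, y) dμ(x)` whose kernel is the generalized function `e` on `X × Y`:
for all Schwartz functions `f` on `X` and `ψ` on `Y`, the integral of `(T f) ψ` over `Y` is the
value of `e` on the test function `f(x) ψ(y)`. -/
def HasKernel {μ : Measure X} {ν : Measure Y} [μ.HasTemperateGrowth]
    (T : Lp ℂ 2 μ →L[ℂ] Lp ℂ 2 ν) (e : 𝓢(X × Y, ℂ) → ℂ) : Prop :=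
  ∀ (f : 𝓢(X, ℂ)) (ψ : 𝓢(Y, ℂ)), ∫ y, T (f.toLp 2 μ) y * ψ y ∂ν = e (f.tensor ψ)

/-- The generalized function `conj (e(x, y))` on `Y × X`, with the variables listed in the other
order. -/
def adjointKernel (e : 𝓢'(X × Y, ℂ)) (Θ : 𝓢(Y × X, ℂ)) : ℂ :=
  conj (e (SchwartzMap.compCLMOfContinuousLinearEquiv ℂ
    (ContinuousLinearEquiv.prodComm ℝ X Y) Θ.conjugate))

/-- `F : L²(X, μ) → L²(Y, ν)` is a generalized Fourier transform with the generalized exponential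
function `e`: it is the transform `(F f)(y) = ∫ f(x) e(x, y) dμ(x)`, the Plancherel formula
`∫ f conj(g) dμ = ∫ (F f) conj(F g) dν` holds (`F` is a linear isometry), and `f` is recovered from
`F f` by the inversion formula `f(x) = ∫ (F f)(y) conj(e(x, y)) dν(y)`. -/
structure IsGeneralizedFourierTransform {μ : Measure X} {ν : Measure Y} [μ.HasTemperateGrowth]
    [ν.HasTemperateGrowth] (e : 𝓢'(X × Y, ℂ)) (F : Lp ℂ 2 μ →L[ℂ] Lp ℂ 2 ν) : Prop where
  hasKernel : HasKernel F e
  plancherel : ∀ f g : Lp ℂ 2 μ,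
    ∫ x, f x * conj (g x) ∂μ = ∫ y, F f y * conj (F g y) ∂ν
  inversion : ∃ G : Lp ℂ 2 ν →L[ℂ] Lp ℂ 2 μ,
    HasKernel G (adjointKernel e) ∧ ∀ f, G (F f) = f

end GFT

/-! Complexes of planes in real space -/

section Planes

/-- Real `n`-space with its Euclidean structure. -/
abbrev RSpace (n : ℕ) : Type := EuclideanSpace ℝ (Fin n)

/-- Lebesgue measure on real `n`-space, normalized by the factor `(2π)^(-n/2)`, so that no
constants occur in the Fourier inversion and Plancherel formulas. -/
def normLebesgue (n : ℕ) : Measure (RSpace n) :=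
  ENNReal.ofReal ((2 * Real.pi) ^ (-(n : ℝ) / 2)) • volume

instance normLebesgue.isAddHaarMeasure (n : ℕ) : (normLebesgue n).IsAddHaarMeasure :=
  Measure.IsAddHaarMeasure.smul _ (by simp; positivity) ENNReal.ofReal_ne_top

/-- The normalized Lebesgue measure on the product of real `m`-space and real `n`-space. -/
abbrev normLebesgueProd (m n : ℕ) : Measure (RSpace m × RSpace n) :=
  (normLebesgue m).prod (normLebesgue n)

instance normLebesgueProd.isAddHaarMeasure (m n : ℕ) :
    (normLebesgueProd m n).IsAddHaarMeasure :=
  Measure.prod.instIsAddHaarMeasure _ _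

instance normLebesgueProd.hasTemperateGrowth (m n : ℕ) :
    (normLebesgueProd m n).HasTemperateGrowth :=
  Measure.IsAddHaarMeasure.instHasTemperateGrowth

variable {k l : ℕ}

/-- The matrix `u(t)` obtained by evaluating the polynomial entries of `u` at `t`. -/
def matrixAt (u : Matrix (Fin l) (Fin k) (MvPolynomial (Fin k) ℝ)) (t : RSpace k) :
    Matrix (Fin l) (Fin k) ℝ :=
  u.map (MvPolynomial.eval fun i => t i)

/-- The vector `u(t) x`. -/
def mulCol (u : Matrix (Fin l) (Fin k) (MvPolynomial (Fin k) ℝ)) (t x : RSpace k) : RSpace l :=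
  WithLp.toLp 2 (Matrix.mulVec (matrixAt u t) fun j => x j)

/-- The row vector `ξ u(t)`. -/
def rowMul (u : Matrix (Fin l) (Fin k) (MvPolynomial (Fin k) ℝ)) (ξ : RSpace l) (t : RSpace k) :
    RSpace k :=
  WithLp.toLp 2 (Matrix.vecMul (fun i => ξ i) (matrixAt u t))

/-- The Jacobian determinant `ω(ξ, t)` of `t ↦ ξ u(t)`. -/
def jacobian (u : Matrix (Fin l) (Fin k) (MvPolynomial (Fin k) ℝ)) (ξ : RSpace l) (t : RSpace k) :
    ℝ :=
  (fderiv ℝ (fun t' => rowMul u ξ t') t).det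

/-- The Crofton function: the number of solutions `t` of the equation `η = -ξ u(t)`. -/
def croftonFunction (u : Matrix (Fin l) (Fin k) (MvPolynomial (Fin k) ℝ)) (η : RSpace k)
    (ξ : RSpace l) : ℕ∞ :=
  {t : RSpace k | η = -rowMul u ξ t}.encard

/-- The change of variables `(s, t), (x, y) ↦ (x, y), (y - u(t) x - s, t)`. -/
def planeMap (u : Matrix (Fin l) (Fin k) (MvPolynomial (Fin k) ℝ))
    (q : (RSpace l × RSpace k) × (RSpace k × RSpace l)) :
    (RSpace k × RSpace l) × (RSpace l × RSpace k) :=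
  (q.2, (q.2.2 - mulCol u q.1.2 q.2.1 - q.1.1, q.1.2))

theorem MvPolynomial.hasTemperateGrowth_eval {D : Type*} [NormedAddCommGroup D] [NormedSpace ℝ D]
    (P : MvPolynomial (Fin k) ℝ) {g : D → RSpace k} (hg : g.HasTemperateGrowth) :
    (fun q => MvPolynomial.eval (fun i => g q i) P).HasTemperateGrowth := by
  induction P using MvPolynomial.induction_on with
  | C a => simp
  | add p q hp hq => simpa using! hp.add hq
  | mul_X p i hp =>
    have : (fun q => g q i).HasTemperateGrowth :=
      (EuclideanSpace.proj (𝕜 := ℝ) i).hasTemperateGrowth.comp hg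
    simpa using! hp.mul this

theorem hasTemperateGrowth_mulCol {D : Type*} [NormedAddCommGroup D] [NormedSpace ℝ D]
    (u : Matrix (Fin l) (Fin k) (MvPolynomial (Fin k) ℝ)) {g h : D → RSpace k}
    (hg : g.HasTemperateGrowth) (hh : h.HasTemperateGrowth) :
    (fun q => mulCol u (g q) (h q)).HasTemperateGrowth := by
  have key : (fun q => mulCol u (g q) (h q)) = fun q => ∑ i, (∑ j,
      MvPolynomial.eval (fun m => g q m) (u i j) * h q j) •
        (EuclideanSpace.single i (1 : ℝ) : RSpace l) := by
    funext q
    ext m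
    simp [mulCol, matrixAt, Matrix.mulVec, dotProduct, Pi.single_apply]
  rw [key]
  refine Function.HasTemperateGrowth.sum fun i _ => ?_
  have hsum : (fun q => ∑ j, MvPolynomial.eval (fun m => g q m) (u i j) * h q j
      ).HasTemperateGrowth := Function.HasTemperateGrowth.sum fun j _ =>
    (MvPolynomial.hasTemperateGrowth_eval _ hg).mul
      ((EuclideanSpace.proj (𝕜 := ℝ) j).hasTemperateGrowth.comp hh)
  exact hsum.smul (Function.HasTemperateGrowth.const _)

theorem HasTemperateGrowth.pair {D A B : Type*} [NormedAddCommGroup D] [NormedSpace ℝ D]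
    [NormedAddCommGroup A] [NormedSpace ℝ A] [NormedAddCommGroup B] [NormedSpace ℝ B]
    {g : D → A} {h : D → B} (hg : g.HasTemperateGrowth) (hh : h.HasTemperateGrowth) :
    (fun q => (g q, h q)).HasTemperateGrowth := by
  have := ((ContinuousLinearMap.inl ℝ A B).hasTemperateGrowth.comp hg).add
    ((ContinuousLinearMap.inr ℝ A B).hasTemperateGrowth.comp hh)
  convert! this using 1
  funext q
  simp

theorem planeMap_hasTemperateGrowth (u : Matrix (Fin l) (Fin k) (MvPolynomial (Fin k) ℝ)) :
    (planeMap u).HasTemperateGrowth := by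
  have h1 := (ContinuousLinearMap.fst ℝ (RSpace l × RSpace k)
    (RSpace k × RSpace l)).hasTemperateGrowth
  have h2 := (ContinuousLinearMap.snd ℝ (RSpace l × RSpace k)
    (RSpace k × RSpace l)).hasTemperateGrowth
  have hs := (ContinuousLinearMap.fst ℝ (RSpace l) (RSpace k)).hasTemperateGrowth.comp h1
  have ht := (ContinuousLinearMap.snd ℝ (RSpace l) (RSpace k)).hasTemperateGrowth.comp h1
  have hx := (ContinuousLinearMap.fst ℝ (RSpace k) (RSpace l)).hasTemperateGrowth.comp h2
  have hy := (ContinuousLinearMap.snd ℝ (RSpace k) (RSpace l)).hasTemperateGrowth.comp h2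
  exact HasTemperateGrowth.pair h2
    (HasTemperateGrowth.pair ((hy.sub (hasTemperateGrowth_mulCol u ht hx)).sub hs) ht)

theorem planeMap_swap_planeMap_swap (u : Matrix (Fin l) (Fin k) (MvPolynomial (Fin k) ℝ))
    (q : (RSpace l × RSpace k) × (RSpace k × RSpace l)) :
    (planeMap u (planeMap u q).swap).swap = q := by
  simp [planeMap]

theorem planeMap_bound (u : Matrix (Fin l) (Fin k) (MvPolynomial (Fin k) ℝ)) :
    ∃ (N : ℕ) (C : ℝ), ∀ q, ‖q‖ ≤ C * (1 + ‖planeMap u q‖) ^ N := by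
  obtain ⟨N, C, h⟩ := (planeMap_hasTemperateGrowth u).2 0
  refine ⟨N, C, fun q => ?_⟩
  have h1 := h (planeMap u q).swap
  have h2 : ∀ {A B : Type} [NormedAddCommGroup A] [NormedAddCommGroup B] (p : A × B),
      ‖p.swap‖ = ‖p‖ := fun p => by simp [Prod.norm_def, max_comm]
  rw [norm_iteratedFDeriv_zero, ← h2, planeMap_swap_planeMap_swap, h2] at h1
  exact h1

/-- The function `(s, t) ↦ ∫ Θ((x, y), (y - u(t) x - s, t)) dx dy`, as a continuous linear function
of the Schwartz function `Θ`. -/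
def planeTest (u : Matrix (Fin l) (Fin k) (MvPolynomial (Fin k) ℝ)) :
    𝓢((RSpace k × RSpace l) × (RSpace l × RSpace k), ℂ) →L[ℂ] 𝓢(RSpace l × RSpace k, ℂ) :=
  (SchwartzMap.fiberIntegral (normLebesgueProd k l)).comp
    (SchwartzMap.compCLM ℂ (planeMap_hasTemperateGrowth u) (planeMap_bound u))

theorem planeTest_apply (u : Matrix (Fin l) (Fin k) (MvPolynomial (Fin k) ℝ))
    (Θ : 𝓢((RSpace k × RSpace l) × (RSpace l × RSpace k), ℂ)) (s : RSpace l) (t : RSpace k) :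
    planeTest u Θ (s, t) =
      ∫ z, Θ (z, (z.2 - mulCol u t z.1 - s, t)) ∂normLebesgueProd k l := rfl

/-- The generalized function `a(y - u(t) x - α, t)` of `(x, y), (α, t)`, which is the kernel of the
transform `(J_a f)(α, t) = ∫ f(x, y) a(y - u(t) x - α, t) dx dy`. By the substitution
`s = y - u(t) x - α`, its value on a test function `Θ` is the value of `a` on the function
`(s, t) ↦ ∫ Θ((x, y), (y - u(t) x - s, t)) dx dy`. -/
def planeKernel (u : Matrix (Fin l) (Fin k) (MvPolynomial (Fin k) ℝ))
    (a : 𝓢'(RSpace l × RSpace k, ℂ)) :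
    𝓢'((RSpace k × RSpace l) × (RSpace l × RSpace k), ℂ) :=
  PointwiseConvergenceCLM.precomp ℂ (planeTest u) a

theorem planeKernel_apply (u : Matrix (Fin l) (Fin k) (MvPolynomial (Fin k) ℝ))
    (a : 𝓢'(RSpace l × RSpace k, ℂ))
    (Θ : 𝓢((RSpace k × RSpace l) × (RSpace l × RSpace k), ℂ)) :
    planeKernel u a Θ = a (planeTest u Θ) := rfl

/-- The Fourier transform `ã(ξ, t) = ∫ a(s, t) e^{i⟨s, ξ⟩} ds` with respect to `s` of the
generalized function `a(s, t)` is the usual (locally integrable) function `ã`, that is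
`a(s, t) = ∫ ã(ξ, t) e^{-i⟨s, ξ⟩} dξ` when both sides are integrated against test functions
`Θ(s, t)`. -/
structure HasPartialFourierTransform (a : 𝓢'(RSpace l × RSpace k, ℂ))
    (a' : RSpace l × RSpace k → ℂ) : Prop where
  locallyIntegrable : LocallyIntegrable a' (normLebesgueProd l k)
  integrable : ∀ Θ : 𝓢(RSpace l × RSpace k, ℂ), Integrable
    (fun p => a' p * ∫ s, Θ (s, p.2) * Complex.exp (-Complex.I * (inner ℝ s p.1 : ℝ))
      ∂normLebesgue l) (normLebesgueProd l k)
  apply_eq : ∀ Θ : 𝓢(RSpace l × RSpace k, ℂ), a Θ =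
    ∫ p, a' p * ∫ s, Θ (s, p.2) * Complex.exp (-Complex.I * (inner ℝ s p.1 : ℝ))
      ∂normLebesgue l ∂normLebesgueProd l k

end Planes

end

/-! On the Fourier side `J_a` is a weighted composition. Writing `a` through its partial transform
and substituting `s = y - u(t)x - α`, the exponent splits and gives `J_a = P ∘ M ∘ U`. Here `U` is
the Fourier transform on ℝᵏ × ℝˡ, `(M g)(ξ, t) = ã(ξ, t) g(φ(ξ, t))` with `φ(ξ, t) = (-ξu(t), ξ)`,
and `P` is the Fourier transform in ξ with t fixed. This is the slice identity
`integral_planeTest_tensor`.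

`U` and `P` are unitary, so everything rests on `M`. The Jacobian of `φ` is `|ω|` and its fibres
have `Cr_K` points, so the area formula reads `∫ |ω| G∘φ = ∫ Cr_K G`. Replacing `G` by `G / Cr_K`
and using `|ã|² = |ω| / (Cr_K ∘ φ)` gives `∫ |ã|² G∘φ = ∫ G` (`lintegral_enorm_sq_mul_comp_rowMul`),
which says that `M` is an isometry.

Hence `J_a` is an isometry: Plancherel holds, and the adjoint is a left inverse whose kernel is the
conjugate one, which is the inversion formula. If `Cr_K = 1` almost everywhere, `φ` is injective off
a null set and `ã ≠ 0` almost everywhere, so `M g = h` can be solved for `g`. -/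

noncomputable section

/-! ### Area formula with multiplicity, and null zero sets of analytic functions. -/

section AreaFormula

/-- Cardinality is the counting measure on the σ-algebra of all subsets, so this is countable
additivity. -/
theorem Set.encard_iUnion_of_pairwise_disjoint {α : Type*} {s : ℕ → Set α}
    (hs : Pairwise (Function.onFun Disjoint s)) :
    ((⋃ n, s n).encard : ℝ≥0∞) = ∑' n, ((s n).encard : ℝ≥0∞) := by
  let _ : MeasurableSpace α := ⊤
  have h : ∀ t : Set α, Measure.count t = t.encard := fun t =>
    Measure.count_apply MeasurableSpace.measurableSet_top
  simp_rw [← h]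
  exact measure_iUnion hs fun n => MeasurableSpace.measurableSet_top

variable {E : Type*} [NormedAddCommGroup E] [NormedSpace ℝ E] [FiniteDimensional ℝ E]
  [MeasurableSpace E] [BorelSpace E] (μ : Measure E) [μ.IsAddHaarMeasure]

/-- Where the derivative is invertible, the domain can be cut into countably many measurable pieces
on which the function is injective. -/
theorem exists_partition_injOn_of_det_ne_zero {f : E → E}
    {f' : E → E →L[ℝ] E} {S : Set E} (hf' : ∀ x ∈ S, HasFDerivWithinAt f (f' x) S x)
    (hS : ∀ x ∈ S, (f' x).det ≠ 0) :
    ∃ t : ℕ → Set E, Pairwise (Function.onFun Disjoint t) ∧ (∀ n, MeasurableSet (t n)) ∧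
      S ⊆ ⋃ n, t n ∧ ∀ n, Set.InjOn f (S ∩ t n) := by
  classical
  -- A map that approximates an invertible `A` with error below `‖A⁻¹‖⁻¹` is injective; the `+ 1`
  -- makes the inequality strict. The value 1 is never used below, since each `A n` is a derivative
  -- at a point of `S`.
  let r : (E →L[ℝ] E) → ℝ≥0 := fun A =>
    if h : A.det ≠ 0 then
      (‖((A.toContinuousLinearEquivOfDetNeZero h).symm : E →L[ℝ] E)‖₊ + 1)⁻¹ else 1
  have rpos : ∀ A, r A ≠ 0 := fun A => by
    simp only [r]
    split_ifs <;> positivity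
  obtain ⟨t, A, hd, hm, hc, happ, hA⟩ :=
    exists_partition_approximatesLinearOn_of_hasFDerivWithinAt f S f' hf' r rpos
  refine ⟨t, hd, hm, hc, fun n => ?_⟩
  rcases S.eq_empty_or_nonempty with h0 | h0
  · simp [h0]
  obtain ⟨y, hy, hAy⟩ := hA h0 n
  have hdet : (A n).det ≠ 0 := hAy ▸ hS y hy
  have h := happ n
  rw [← (A n).coe_toContinuousLinearEquivOfDetNeZero hdet] at h
  refine h.injOn ?_
  rcases subsingleton_or_nontrivial E with hE | hE
  · exact Or.inl hE
  · right
    rw [(A n).coe_toContinuousLinearEquivOfDetNeZero hdet]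
    simp only [r, dif_pos hdet]
    have hpos : 0 < ‖(((A n).toContinuousLinearEquivOfDetNeZero hdet).symm : E →L[ℝ] E)‖₊ :=
      ContinuousLinearEquiv.nnnorm_symm_pos _
    exact inv_strictAnti₀ hpos (lt_add_one _)

/-- The area formula: under a differentiable map the measure with density `|det f'|` is pushed
forward to the measure whose density is the number of preimages. -/
theorem exists_measurable_multiplicity {f : E → E} {f' : E → E →L[ℝ] E}
    (hf' : ∀ x, HasFDerivAt f (f' x) x) (hdet : Measurable fun x => (f' x).det) :
    ∃ N : E → ℝ≥0∞, Measurable N ∧ (∀ᵐ y ∂μ, N y = ((f ⁻¹' {y}).encard : ℝ≥0∞)) ∧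
      ∀ G : E → ℝ≥0∞, Measurable G →
        ∫⁻ x, ENNReal.ofReal |(f' x).det| * G (f x) ∂μ = ∫⁻ y, N y * G y ∂μ := by
  set S : Set E := {x | (f' x).det ≠ 0} with hSdef
  have hS : MeasurableSet S := (hdet (measurableSet_singleton 0)).compl
  have hfS : ∀ x ∈ S, HasFDerivWithinAt f (f' x) S x := fun x _ => (hf' x).hasFDerivWithinAt
  obtain ⟨t, hd, hm, hc, hinj⟩ := exists_partition_injOn_of_det_ne_zero hfS (fun x hx => hx)
  have hmS : ∀ n, MeasurableSet (S ∩ t n) := fun n => hS.inter (hm n)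
  have hdS : Pairwise (Function.onFun Disjoint fun n => S ∩ t n) := fun i j hij =>
    (hd hij).mono Set.inter_subset_right Set.inter_subset_right
  have hUn : ⋃ n, S ∩ t n = S := by
    rw [← Set.inter_iUnion, Set.inter_eq_left]
    exact hc
  have hfn : ∀ n, ∀ x ∈ S ∩ t n, HasFDerivWithinAt f (f' x) (S ∩ t n) x :=
    fun n x _ => (hf' x).hasFDerivWithinAt
  have him : ∀ n, MeasurableSet (f '' (S ∩ t n)) := fun n =>
    measurable_image_of_fderivWithin (hmS n) (hfn n) (hinj n)
  have hNm : ∀ n, Measurable ((f '' (S ∩ t n)).indicator (1 : E → ℝ≥0∞)) := fun n =>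
    measurable_one.indicator (him n)
  -- `N y` counts the pieces whose image contains `y`, which is the number of preimages in `S`
  -- because `f` is injective on each piece. Critical points are missed, but by Sard their image is
  -- null, hence equality only almost everywhere.
  refine ⟨fun y => ∑' n, (f '' (S ∩ t n)).indicator 1 y, Measurable.tsum hNm, ?_,
    fun G hG => ?_⟩
  · have hnull : μ (f '' Sᶜ) = 0 := by
      refine addHaar_image_eq_zero_of_det_fderivWithin_eq_zero μ (f' := f')
        (fun x _ => (hf' x).hasFDerivWithinAt) fun x hx => ?_
      simpa [hSdef] using hx
    filter_upwards [measure_eq_zero_iff_ae_notMem.1 hnull] with y hy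
    have hsub : f ⁻¹' {y} ⊆ S := fun x hx => by
      by_contra hxS
      exact hy ⟨x, hxS, hx⟩
    have hdec : f ⁻¹' {y} = ⋃ n, f ⁻¹' {y} ∩ (S ∩ t n) := by
      rw [← Set.inter_iUnion, hUn, Set.inter_eq_left.2 hsub]
    rw [hdec, Set.encard_iUnion_of_pairwise_disjoint fun i j hij =>
      (hdS hij).mono Set.inter_subset_right Set.inter_subset_right]
    refine tsum_congr fun n => ?_
    by_cases hyn : y ∈ f '' (S ∩ t n)
    · obtain ⟨x, hx, rfl⟩ := hyn
      have : f ⁻¹' {f x} ∩ (S ∩ t n) = {x} := by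
        ext z
        constructor
        · rintro ⟨h1, h2⟩
          exact hinj n h2 hx h1
        · rintro rfl
          exact ⟨rfl, hx⟩
      rw [Set.indicator_of_mem (Set.mem_image_of_mem f hx), this]
      simp
    · have : f ⁻¹' {y} ∩ (S ∩ t n) = ∅ := by
        ext z
        simp only [Set.mem_inter_iff, Set.mem_empty_iff_false, iff_false]
        rintro ⟨h1, h2⟩
        exact hyn ⟨z, h2, h1⟩
      rw [Set.indicator_of_notMem hyn, this]
      simp
  -- The weight vanishes off `S`; on each piece the injective change of variables applies, and the
  -- pieces are summed.
  · calc _ = ∫⁻ x in S, ENNReal.ofReal |(f' x).det| * G (f x) ∂μ := by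
          refine (setLIntegral_eq_of_support_subset fun x hx => ?_).symm
          intro h0
          simp [h0] at hx
      _ = ∑' n, ∫⁻ x in S ∩ t n, ENNReal.ofReal |(f' x).det| * G (f x) ∂μ := by
          rw [← lintegral_iUnion hmS hdS, hUn]
      _ = ∑' n, ∫⁻ y in f '' (S ∩ t n), G y ∂μ := tsum_congr fun n =>
          (lintegral_image_eq_lintegral_abs_det_fderiv_mul μ (hmS n) (hfn n) (hinj n) G).symm
      _ = ∑' n, ∫⁻ y, (f '' (S ∩ t n)).indicator 1 y * G y ∂μ := tsum_congr fun n => by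
          rw [← lintegral_indicator (him n)]
          refine lintegral_congr fun y => ?_
          by_cases hy : y ∈ f '' (S ∩ t n) <;> simp [hy]
      _ = _ := by
          rw [← lintegral_tsum fun n => by exact ((hNm n).mul hG).aemeasurable]
          simp_rw [ENNReal.tsum_mul_right]

/-- An analytic function that is not identically zero is nonzero almost everywhere. -/
theorem AnalyticOnNhd.ae_ne_zero {f : E → ℝ} (hf : AnalyticOnNhd ℝ f Set.univ) {p : E}
    (hp : f p ≠ 0) : ∀ᵐ x ∂μ, f x ≠ 0 := by
  have hcont : Continuous f := continuous_iff_continuousAt.2 fun x => (hf x trivial).continuousAt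
  set ν : Measure ℝ := volume.restrict (Set.Ioo 0 1)
  -- `H (x, r)` contracts `x` towards `p` by the factor `1 - r`, so `H (x, 1) = p`. Along each such
  -- line `f` is a one-variable analytic function, nonzero at `r = 1`, so its zeros form a null set.
  -- Fubini then gives some `r < 1` for which `x ↦ f (H (x, r))` has null zero set, and the
  -- homothety of ratio `1 - r` carries that set onto the zeros of `f`.
  let H : E × ℝ → E := fun q => AffineMap.homothety p (1 - q.2) q.1
  have hHc : Continuous H := by
    simp only [H, AffineMap.homothety_apply, vsub_eq_sub, vadd_eq_add]
    fun_prop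
  have hH : MeasurableSet {q | f (H q) = 0} :=
    (isClosed_singleton.preimage (hcont.comp hHc)).measurableSet
  have h1 : ∀ x, ν {r | f (H (x, r)) = 0} = 0 := fun x => by
    have han : AnalyticOnNhd ℝ (fun r : ℝ => f (H (x, r))) Set.univ := fun r _ => by
      refine (hf (H (x, r)) trivial).fun_comp (g := f) (f := fun r : ℝ => H (x, r)) ?_
      simp only [H, AffineMap.homothety_apply, vsub_eq_sub, vadd_eq_add]
      fun_prop
    have h2 := han.preimage_zero_mem_codiscreteWithin (x := 1) (by simpa [H] using hp) trivial
      isConnected_univ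
    have h3 := ae_restrict_le_codiscreteWithin (μ := volume) MeasurableSet.univ h2
    rw [Measure.restrict_univ] at h3
    refine Measure.absolutelyContinuous_of_le Measure.restrict_le_self ?_
    exact measure_mono_null (fun r hr => by simpa using hr) (mem_ae_iff.1 h3)
  have h2 : (μ.prod ν) {q | f (H q) = 0} = 0 := by
    rw [Measure.measure_prod_null hH]
    exact Eventually.of_forall h1
  have h3 : (ν.prod μ) (Prod.swap ⁻¹' {q | f (H q) = 0}) = 0 := by
    rw [← Measure.map_apply measurable_swap hH, Measure.prod_swap, h2]
  have h4 := Measure.measure_ae_null_of_prod_null h3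
  have h5 : ∀ᵐ r ∂ν, r ∈ Set.Ioo (0 : ℝ) 1 := ae_restrict_mem measurableSet_Ioo
  have : (ae ν).NeBot := by
    rw [ae_neBot]
    simp [ν, Measure.restrict_eq_zero]
  obtain ⟨r, hr, hr1⟩ := (h4.and h5).exists
  have hr0 : 1 - r ≠ 0 := by linarith [hr1.2]
  rw [ae_iff]
  simp only [ne_eq, not_not]
  have himg : {x | f x = 0} ⊆ AffineMap.homothety p (1 - r) ''
      (Prod.mk r ⁻¹' (Prod.swap ⁻¹' {q | f (H q) = 0})) := fun x hx => by
    have hy : AffineMap.homothety p (1 - r) (AffineMap.homothety p (1 - r)⁻¹ x) = x := by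
      rw [← AffineMap.homothety_mul_apply, mul_inv_cancel₀ hr0]
      simp
    refine ⟨_, ?_, hy⟩
    simpa [H, hy] using hx
  refine measure_mono_null himg ?_
  rw [Measure.addHaar_image_homothety]
  simp only [Pi.zero_apply] at hr
  rw [hr, mul_zero]

end AreaFormula

/-! ### Block triangular determinants and analyticity of the determinant. -/

section Determinants

theorem LinearMap.det_coprod_prod_snd {V W : Type*} [AddCommGroup V] [Module ℝ V]
    [AddCommGroup W] [Module ℝ W] [FiniteDimensional ℝ V] [FiniteDimensional ℝ W]
    (A : V →ₗ[ℝ] V) (B : W →ₗ[ℝ] V) (D : W →ₗ[ℝ] W) :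
    LinearMap.det ((A.coprod B).prod (D ∘ₗ LinearMap.snd ℝ V W)) =
      LinearMap.det A * LinearMap.det D := by
  classical
  let b := Module.Free.chooseBasis ℝ V
  let c := Module.Free.chooseBasis ℝ W
  have h : LinearMap.toMatrix (b.prod c) (b.prod c)
      ((A.coprod B).prod (D ∘ₗ LinearMap.snd ℝ V W)) =
      Matrix.fromBlocks (LinearMap.toMatrix b b A) (LinearMap.toMatrix c b B) 0
        (LinearMap.toMatrix c c D) := by
    ext (i | i) (j | j) <;> simp [LinearMap.toMatrix_apply]
  rw [← LinearMap.det_toMatrix (b.prod c), h, Matrix.det_fromBlocks_zero₂₁,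
    LinearMap.det_toMatrix, LinearMap.det_toMatrix]

/-- By the Leibniz formula the determinant is a polynomial in matrix entries, which are linear
functions of the operator. -/
theorem ContinuousLinearMap.analyticAt_det {E : Type*} [NormedAddCommGroup E] [NormedSpace ℝ E]
    [FiniteDimensional ℝ E] (A : E →L[ℝ] E) :
    AnalyticAt ℝ (fun A : E →L[ℝ] E => A.det) A := by
  classical
  let b := Module.Free.chooseBasis ℝ E
  have h : (fun A : E →L[ℝ] E => A.det) = fun A : E →L[ℝ] E =>
      ∑ σ : Equiv.Perm (Module.Free.ChooseBasisIndex ℝ E),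
        ((Equiv.Perm.sign σ : ℤ) : ℝ) * ∏ i, b.repr (A (b i)) (σ i) := by
    funext A
    rw [ContinuousLinearMap.det, ← LinearMap.det_toMatrix b, Matrix.det_apply']
    simp [LinearMap.toMatrix_apply]
  rw [h]
  refine Finset.analyticAt_fun_sum _ fun σ _ => analyticAt_const.mul
    (Finset.analyticAt_fun_prod _ fun i _ => ?_)
  let L : (E →L[ℝ] E) →L[ℝ] ℝ :=
    (LinearMap.toContinuousLinearMap (b.coord (σ i))).comp
      (ContinuousLinearMap.apply ℝ E (b i))
  exact L.analyticAt A

end Determinants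

/-! ### The map `(ξ, t) ↦ (-ξu(t), ξ)`: Jacobian, fibres, null sets. -/

section CroftonMap

variable {k l : ℕ} (u : Matrix (Fin l) (Fin k) (MvPolynomial (Fin k) ℝ))

/-- The endomorphism `(t, ξ) ↦ (-ξ u(t), ξ)`. -/
def dualPlaneMap (p : RSpace k × RSpace l) : RSpace k × RSpace l :=
  (-rowMul u p.2 p.1, p.2)

theorem rowMul_apply (ξ : RSpace l) (t : RSpace k) (j : Fin k) :
    rowMul u ξ t j = ∑ i, ξ i * MvPolynomial.eval (fun m => t m) (u i j) := by
  simp [rowMul, matrixAt, Matrix.vecMul, dotProduct]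

theorem analyticAt_rowMul (p : RSpace k × RSpace l) :
    AnalyticAt ℝ (fun p : RSpace k × RSpace l => rowMul u p.2 p.1) p := by
  have key : (fun p : RSpace k × RSpace l => rowMul u p.2 p.1) = fun p => ∑ j, (∑ i,
      p.2 i * MvPolynomial.eval (fun m => p.1 m) (u i j)) •
        (EuclideanSpace.single j (1 : ℝ) : RSpace k) := by
    funext q
    ext m
    simp [rowMul_apply, Pi.single_apply]
  have h1 : ∀ i, AnalyticAt ℝ (fun p : RSpace k × RSpace l => p.2 i) p := fun i =>
    ((EuclideanSpace.proj (𝕜 := ℝ) i).comp (ContinuousLinearMap.snd ℝ _ _)).analyticAt p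
  have h2 : ∀ i, AnalyticAt ℝ (fun p : RSpace k × RSpace l => p.1 i) p := fun i =>
    ((EuclideanSpace.proj (𝕜 := ℝ) i).comp (ContinuousLinearMap.fst ℝ _ _)).analyticAt p
  rw [key]
  refine Finset.analyticAt_fun_sum _ fun j _ => AnalyticAt.fun_smul
    (Finset.analyticAt_fun_sum _ fun i _ => (h1 i).mul ?_) analyticAt_const
  have := AnalyticAt.aeval_mvPolynomial (𝕜 := ℝ) (f := fun p : RSpace k × RSpace l =>
    fun m => p.1 m) h2 (u i j)
  simpa [MvPolynomial.aeval_eq_eval] using this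

theorem analyticAt_dualPlaneMap (p : RSpace k × RSpace l) :
    AnalyticAt ℝ (dualPlaneMap u) p :=
  (analyticAt_rowMul u p).neg.prod analyticAt_snd

theorem hasFDerivAt_dualPlaneMap (p : RSpace k × RSpace l) :
    HasFDerivAt (dualPlaneMap u) (fderiv ℝ (dualPlaneMap u) p) p :=
  (analyticAt_dualPlaneMap u p).differentiableAt.hasFDerivAt

theorem analyticAt_det_fderiv_dualPlaneMap (p : RSpace k × RSpace l) :
    AnalyticAt ℝ (fun p => (fderiv ℝ (dualPlaneMap u) p).det) p :=
  (ContinuousLinearMap.analyticAt_det _).fun_comp (analyticAt_dualPlaneMap u p).fderiv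

theorem continuous_det_fderiv_dualPlaneMap :
    Continuous (fun p => (fderiv ℝ (dualPlaneMap u) p).det) :=
  continuous_iff_continuousAt.2 fun p => (analyticAt_det_fderiv_dualPlaneMap u p).continuousAt

/-- The derivative is block triangular, with diagonal blocks minus the t-derivative of `ξu(t)` and
the identity; the absolute value removes the sign `(-1)^k`. -/
theorem abs_det_fderiv_dualPlaneMap (p : RSpace k × RSpace l) :
    |(fderiv ℝ (dualPlaneMap u) p).det| = |jacobian u p.2 p.1| := by
  set R := fun p : RSpace k × RSpace l => rowMul u p.2 p.1
  have hR : HasFDerivAt R (fderiv ℝ R p) p := (analyticAt_rowMul u p).differentiableAt.hasFDerivAt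
  have h1 : HasFDerivAt (fun t => rowMul u p.2 t)
      ((fderiv ℝ R p).comp (ContinuousLinearMap.inl ℝ _ _)) p.1 :=
    HasFDerivAt.comp (g := R) (f := fun t => (t, p.2)) p.1 hR (hasFDerivAt_prodMk_left p.1 p.2)
  have h2 : HasFDerivAt (dualPlaneMap u)
      ((-fderiv ℝ R p).prod (ContinuousLinearMap.snd ℝ _ _)) p :=
    hR.neg.prodMk hasFDerivAt_snd
  rw [h2.fderiv, jacobian, h1.fderiv]
  set A : RSpace k →L[ℝ] RSpace k := (fderiv ℝ R p).comp (ContinuousLinearMap.inl ℝ _ _)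
  have h3 : (((-fderiv ℝ R p).prod (ContinuousLinearMap.snd ℝ (RSpace k) (RSpace l)) :
      RSpace k × RSpace l →L[ℝ] RSpace k × RSpace l) :
      RSpace k × RSpace l →ₗ[ℝ] RSpace k × RSpace l) =
      ((-(A : RSpace k →ₗ[ℝ] RSpace k)).coprod
        (-(((fderiv ℝ R p).comp (ContinuousLinearMap.inr ℝ _ _) : RSpace l →L[ℝ] RSpace k) :
          RSpace l →ₗ[ℝ] RSpace k))).prod (LinearMap.id ∘ₗ LinearMap.snd ℝ _ _) := by
    ext <;> simp [A]
    all_goals exact congrFun (congrArg WithLp.ofLp (map_zero (fderiv ℝ R p))) _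
  rw [ContinuousLinearMap.det, h3, LinearMap.det_coprod_prod_snd, LinearMap.det_id, mul_one,
    ContinuousLinearMap.det, ← neg_one_smul ℝ (A : RSpace k →ₗ[ℝ] RSpace k), LinearMap.det_smul,
    abs_mul, abs_pow, abs_neg, abs_one, one_pow, one_mul]

/-- A point of the fibre is determined by `t`, since its second coordinate must be `q.2`. -/
theorem encard_dualPlaneMap_preimage (q : RSpace k × RSpace l) :
    (dualPlaneMap u ⁻¹' {q}).encard = croftonFunction u q.1 q.2 := by
  have : dualPlaneMap u ⁻¹' {q} = (fun t => (t, q.2)) '' {t | q.1 = -rowMul u q.2 t} := by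
    ext ⟨t, ξ⟩
    simp only [dualPlaneMap, Set.mem_preimage, Set.mem_singleton_iff, Prod.ext_iff, Set.mem_image,
      Set.mem_ofPred_eq]
    constructor
    · rintro ⟨h1, h2⟩
      exact ⟨t, by rw [← h1, ← h2], rfl, h2.symm⟩
    · rintro ⟨t', h1, h2, h3⟩
      rw [← h2, ← h3]
      exact ⟨h1.symm, rfl⟩
  rw [this, Set.InjOn.encard_image fun a _ b _ h => (Prod.ext_iff.1 h).1]
  rfl

/-- The area formula for the map `(ξ, t) ↦ (-ξ u(t), ξ)`. -/
theorem exists_measurable_crofton :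
    ∃ N : RSpace k × RSpace l → ℝ≥0∞, Measurable N ∧
      (∀ᵐ q ∂normLebesgueProd k l, N q = (croftonFunction u q.1 q.2 : ℝ≥0∞)) ∧
      ∀ G : RSpace k × RSpace l → ℝ≥0∞, Measurable G →
        ∫⁻ p, ENNReal.ofReal |jacobian u p.1 p.2| * G (-rowMul u p.1 p.2, p.1)
          ∂normLebesgueProd l k = ∫⁻ q, N q * G q ∂normLebesgueProd k l := by
  obtain ⟨N, h1, h2, h3⟩ := exists_measurable_multiplicity (normLebesgueProd k l)
    (hasFDerivAt_dualPlaneMap u) (continuous_det_fderiv_dualPlaneMap u).measurable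
  simp_rw [encard_dualPlaneMap_preimage] at h2
  refine ⟨N, h1, h2, fun G hG => ?_⟩
  rw [← h3 G hG]
  simp_rw [abs_det_fderiv_dualPlaneMap]
  exact lintegral_prod_swap
    (fun p : RSpace k × RSpace l => ENNReal.ofReal |jacobian u p.2 p.1| * G (dualPlaneMap u p))

variable {u} (hCr : ∀ᵐ p : RSpace k × RSpace l ∂normLebesgueProd k l,
  croftonFunction u p.1 p.2 ≠ 0 ∧ croftonFunction u p.1 p.2 ≠ ⊤)

include hCr in
-- If ω vanished identically, the area formula with `G = 1` would force the Crofton function to be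
-- zero almost everywhere, against `hCr`. Being analytic and not identically zero, ω is nonzero
-- almost everywhere.
theorem ae_jacobian_ne_zero :
    ∀ᵐ p : RSpace l × RSpace k ∂normLebesgueProd l k, jacobian u p.1 p.2 ≠ 0 := by
  have key : ∃ p : RSpace k × RSpace l, (fderiv ℝ (dualPlaneMap u) p).det ≠ 0 := by
    by_contra! h
    obtain ⟨N, h1, h2, h3⟩ := exists_measurable_crofton u
    have h4 := h3 1 measurable_one
    have h5 : ∀ p : RSpace l × RSpace k, |jacobian u p.1 p.2| = 0 := fun p => by
      have := abs_det_fderiv_dualPlaneMap u p.swap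
      rw [h, abs_zero] at this
      exact this.symm
    simp only [h5, ENNReal.ofReal_zero, lintegral_zero, Pi.one_apply, mul_one] at h4
    have h6 := (lintegral_eq_zero_iff h1).1 h4.symm
    obtain ⟨q, ha, hb, hc⟩ := (h6.and (h2.and hCr)).exists
    rw [hb] at ha
    exact hc.1 (by simpa using ha)
  obtain ⟨p, hp⟩ := key
  have h := AnalyticOnNhd.ae_ne_zero (normLebesgueProd k l)
    (fun p _ => analyticAt_det_fderiv_dualPlaneMap u p) hp
  have h' := (Measure.measurePreserving_swap (μ := normLebesgue l)
    (ν := normLebesgue k)).quasiMeasurePreserving.ae h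
  filter_upwards [h'] with q hq h0
  rw [← abs_ne_zero, abs_det_fderiv_dualPlaneMap] at hq
  exact hq (by simpa using h0)

theorem continuous_rowMul_prod :
    Continuous fun p : RSpace l × RSpace k => (-rowMul u p.1 p.2, p.1) := by
  have : Continuous (dualPlaneMap u) :=
    continuous_iff_continuousAt.2 fun p => (analyticAt_dualPlaneMap u p).continuousAt
  exact this.comp continuous_swap

include hCr in
-- For a null set `s` the area formula gives `∫ |ω| 1_s∘φ = 0`, and ω is nonzero almost everywhere,
-- so the preimage of `s` is null. This makes `g ∘ φ` meaningful for classes `g` in `L²` and lets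
-- almost-everywhere statements about `Cr_K` be pulled back.
theorem quasiMeasurePreserving_rowMul :
    Measure.QuasiMeasurePreserving
      (fun p : RSpace l × RSpace k => (-rowMul u p.1 p.2, p.1))
      (normLebesgueProd l k) (normLebesgueProd k l) := by
  refine ⟨continuous_rowMul_prod.measurable, Measure.AbsolutelyContinuous.mk fun s hs h0 => ?_⟩
  rw [Measure.map_apply continuous_rowMul_prod.measurable hs]
  obtain ⟨N, h1, h2, h3⟩ := exists_measurable_crofton u
  have h4 := h3 (s.indicator 1) (measurable_one.indicator hs)
  have h5 : ∫⁻ q, N q * s.indicator 1 q ∂normLebesgueProd k l = 0 := by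
    refine (lintegral_eq_zero_iff (h1.mul (measurable_one.indicator hs))).2 ?_
    filter_upwards [measure_eq_zero_iff_ae_notMem.1 h0] with q hq
    simp [hq]
  have hJ : Measurable fun p : RSpace l × RSpace k => |jacobian u p.1 p.2| := by
    have := ((continuous_det_fderiv_dualPlaneMap u).abs.comp continuous_swap).measurable
    convert! this using 1
    funext p
    exact (abs_det_fderiv_dualPlaneMap u p.swap).symm
  rw [h5] at h4
  replace h4 := (lintegral_eq_zero_iff (hJ.ennreal_ofReal.mul
    ((measurable_one.indicator hs).comp continuous_rowMul_prod.measurable))).1 h4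
  rw [measure_eq_zero_iff_ae_notMem]
  filter_upwards [h4, ae_jacobian_ne_zero hCr] with p hp hj hps
  simp only [Pi.zero_apply, Pi.mul_apply, Function.comp_apply, mul_eq_zero,
    ENNReal.ofReal_eq_zero] at hp
  rcases hp with hp | hp
  · exact hj (abs_nonpos_iff.1 hp)
  · rw [Set.indicator_of_mem (Set.mem_preimage.1 hps)] at hp
    exact one_ne_zero hp

variable {a' : RSpace l × RSpace k → ℂ} (ha' : ∀ᵐ p : RSpace l × RSpace k ∂normLebesgueProd l k,
  ‖a' p‖ = ((croftonFunction u (-rowMul u p.1 p.2) p.1).toNat : ℝ) ^ (-(1 / 2) : ℝ) *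
    |jacobian u p.1 p.2| ^ (1 / 2 : ℝ))

include hCr ha' in
-- The key identity: the area formula for `N⁻¹ G`, where `N` is almost everywhere neither 0 nor ∞,
-- and the weight `|ω| / N∘φ` is exactly `|ã|²`.
theorem lintegral_enorm_sq_mul_comp_rowMul {G : RSpace k × RSpace l → ℝ≥0∞} (hG : Measurable G) :
    ∫⁻ p, ‖a' p‖ₑ ^ 2 * G (-rowMul u p.1 p.2, p.1) ∂normLebesgueProd l k =
      ∫⁻ q, G q ∂normLebesgueProd k l := by
  obtain ⟨N, h1, h2, h3⟩ := exists_measurable_crofton u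
  have h4 := h3 _ (h1.inv.mul hG)
  have h5 : ∫⁻ q, N q * (N⁻¹ * G) q ∂normLebesgueProd k l = ∫⁻ q, G q ∂normLebesgueProd k l := by
    refine lintegral_congr_ae ?_
    filter_upwards [h2, hCr] with q hN hq
    rw [Pi.mul_apply, Pi.inv_apply, ← mul_assoc, ENNReal.mul_inv_cancel, one_mul]
    · rw [hN]
      simpa using hq.1
    · rw [hN]
      simpa using hq.2
  rw [← h5, ← h4]
  refine lintegral_congr_ae ?_
  filter_upwards [ha', (quasiMeasurePreserving_rowMul hCr).ae (h2.and hCr)] with p hp hq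
  obtain ⟨hN, hq0, hqt⟩ := hq
  rw [Pi.mul_apply, Pi.inv_apply, ← mul_assoc]
  congr 1
  -- Finiteness of the Crofton value rules out the default `toNat ⊤ = 0`.
  obtain ⟨m, hm⟩ := ENat.ne_top_iff_exists.1 hqt
  rw [hN]
  rw [← hm] at hp hq0 ⊢
  have hm0 : (0 : ℝ) < m := by
    have : m ≠ 0 := by simpa using hq0
    positivity
  rw [← ofReal_norm, hp, ENat.toNat_natCast, ← ENNReal.ofReal_pow (by positivity), mul_pow,
    ← Real.rpow_natCast, ← Real.rpow_natCast, ← Real.rpow_mul hm0.le,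
    ← Real.rpow_mul (abs_nonneg _)]
  norm_num
  rw [Real.rpow_neg_one, ENNReal.ofReal_mul (by positivity), ENNReal.ofReal_inv_of_pos hm0,
    ENNReal.ofReal_natCast, mul_comm]

include hCr ha' in
theorem ae_ne_zero_of_norm_eq : ∀ᵐ p ∂normLebesgueProd l k, a' p ≠ 0 := by
  filter_upwards [ha', ae_jacobian_ne_zero hCr, (quasiMeasurePreserving_rowMul hCr).ae hCr]
    with p hp hj hq
  obtain ⟨m, hm⟩ := ENat.ne_top_iff_exists.1 hq.2
  rw [← hm] at hp hq
  have hm0 : (0 : ℝ) < m := by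
    have : m ≠ 0 := by simpa using hq.1
    positivity
  rw [← norm_ne_zero_iff, hp, ENat.toNat_natCast]
  have := abs_pos.2 hj
  positivity

end CroftonMap

/-! ### Symmetric isometries of `L²` are unitary. -/

section SymmetricIsometry

/-- Pointwise complex conjugation on `L²`. -/
def conjLp {X : Type*} [MeasurableSpace X] (μ : Measure X) : Lp ℂ 2 μ →L[ℝ] Lp ℂ 2 μ :=
  (Complex.conjCLE : ℂ →L[ℝ] ℂ).compLpL 2 μ

theorem coeFn_conjLp {X : Type*} [MeasurableSpace X] {μ : Measure X} (h : Lp ℂ 2 μ) :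
    conjLp μ h =ᵐ[μ] fun x => conj (h x) :=
  ContinuousLinearMap.coeFn_compLpL _ h

theorem conjLp_conjLp {X : Type*} [MeasurableSpace X] {μ : Measure X} (h : Lp ℂ 2 μ) :
    conjLp μ (conjLp μ h) = h := by
  refine Lp.ext ?_
  filter_upwards [coeFn_conjLp (conjLp μ h), coeFn_conjLp h] with x h1 h2
  rw [h1, h2, Complex.conj_conj]

/-- Translates between the bilinear pairing used for kernels and the inner product, which is
conjugate-linear on the left. -/
theorem inner_conjLp {X : Type*} [MeasurableSpace X] {μ : Measure X} (h g : Lp ℂ 2 μ) :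
    inner ℂ (conjLp μ h) g = ∫ x, h x * g x ∂μ := by
  rw [L2.inner_def]
  refine integral_congr_ae ?_
  filter_upwards [coeFn_conjLp h] with x hx
  rw [hx, RCLike.inner_apply, Complex.conj_conj, mul_comm]

theorem eLpNorm_two_eq {X : Type*} [MeasurableSpace X] (μ : Measure X) (f : X → ℂ) :
    eLpNorm f 2 μ = (∫⁻ x, ‖f x‖ₑ ^ 2 ∂μ) ^ (1 / 2 : ℝ) := by
  rw [eLpNorm_eq_lintegral_rpow_enorm_toReal two_ne_zero ENNReal.ofNat_ne_top]
  simp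

/-- A linear isometry of `L²` that is symmetric for the bilinear pairing `∫ h g` is onto. -/
theorem LinearIsometry.surjective_of_inner_conjLp {X : Type*} [MeasurableSpace X]
    {μ : Measure X} (U : Lp ℂ 2 μ →ₗᵢ[ℂ] Lp ℂ 2 μ)
    (hU : ∀ h g, inner ℂ (conjLp μ (U h)) g = inner ℂ (conjLp μ h) (U g)) :
    Function.Surjective U := by
  intro y
  refine ⟨conjLp μ (U (conjLp μ y)), ?_⟩
  -- Symmetry says that the adjoint of `U` is its conjugate by `conjLp`, so this is `U* U = 1`.
  -- Conjugating both sides turns it into a right inverse of `U`.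
  have h1 : ∀ a, conjLp μ (U (conjLp μ (U a))) = a := fun a => by
    refine ext_inner_right ℂ fun b => ?_
    rw [hU, conjLp_conjLp, U.inner_map_map]
  have h2 := congrArg (conjLp μ) (h1 (conjLp μ y))
  rwa [conjLp_conjLp, conjLp_conjLp] at h2

variable {X : Type*} [NormedAddCommGroup X] [NormedSpace ℝ X] [FiniteDimensional ℝ X]
  [MeasurableSpace X] [BorelSpace X] {μ : Measure X} [μ.HasTemperateGrowth]
  [IsFiniteMeasureOnCompacts μ]

/-- A transform of Schwartz functions that preserves the `L²` norm and is symmetric for the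
bilinear pairing extends to a unitary operator of `L²`. -/
theorem exists_linearIsometryEquiv_of_symmetric (T : 𝓢(X, ℂ) → X → ℂ)
    (hadd : ∀ f g, T (f + g) = T f + T g) (hsmul : ∀ (c : ℂ) f, T (c • f) = c • T f)
    (hmeas : ∀ f, AEStronglyMeasurable (T f) μ)
    (hnorm : ∀ f, ∫⁻ x, ‖T f x‖ₑ ^ 2 ∂μ = ∫⁻ x, ‖f x‖ₑ ^ 2 ∂μ)
    (hsymm : ∀ f g, MemLp (T f) 2 μ → MemLp (T g) 2 μ →
      ∫ x, T f x * g x ∂μ = ∫ x, f x * T g x ∂μ) :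
    ∃ U : Lp ℂ 2 μ ≃ₗᵢ[ℂ] Lp ℂ 2 μ, (∀ f : 𝓢(X, ℂ), U (f.toLp 2 μ) =ᵐ[μ] T f) ∧
      ∀ (h : Lp ℂ 2 μ) (g : 𝓢(X, ℂ)), ∫ x, U h x * g x ∂μ = ∫ x, h x * T g x ∂μ := by
  have hnorm' : ∀ f, eLpNorm (T f) 2 μ = eLpNorm f 2 μ := fun f => by
    rw [eLpNorm_two_eq, eLpNorm_two_eq, hnorm]
  have hmem : ∀ f, MemLp (T f) 2 μ := fun f =>
    ⟨hmeas f, by rw [hnorm']; exact f.eLpNorm_lt_top 2 μ⟩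
  let K : 𝓢(X, ℂ) →ₗ[ℂ] Lp ℂ 2 μ :=
    { toFun := fun f => (hmem f).toLp (T f)
      map_add' := fun f g => by
        rw [← MemLp.toLp_add]
        exact MemLp.toLp_congr _ _ (by rw [hadd])
      map_smul' := fun c f => by
        rw [RingHom.id_apply, ← MemLp.toLp_const_smul]
        exact MemLp.toLp_congr _ _ (by rw [hsmul]) }
  have hKae : ∀ f, K f =ᵐ[μ] T f := fun f => (hmem f).coeFn_toLp
  let e : 𝓢(X, ℂ) →ₗ[ℂ] Lp ℂ 2 μ := (SchwartzMap.toLpCLM ℂ ℂ 2 μ).toLinearMap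
  have hdense : DenseRange e :=
    SchwartzMap.denseRange_toLpCLM (E := X) (F := ℂ) (p := 2) (μ := μ) ENNReal.ofNat_ne_top
  have hKnorm : ∀ f, ‖K f‖ = ‖e f‖ := fun f => by
    change ‖(hmem f).toLp (T f)‖ = ‖f.toLp 2 μ‖
    rw [Lp.norm_toLp, SchwartzMap.norm_toLp, hnorm']
  -- Schwartz functions are dense, so norm preservation and symmetry both pass to the extension by
  -- continuity.
  let U₀ : Lp ℂ 2 μ →L[ℂ] Lp ℂ 2 μ := K.extendOfNorm e
  have hU₀ : ∀ f, U₀ (e f) = K f := fun f =>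
    LinearMap.extendOfNorm_eq hdense ⟨1, fun f => by rw [one_mul, hKnorm]⟩ f
  have hiso : ∀ h, ‖U₀ h‖ = ‖h‖ := fun h => by
    refine hdense.induction_on (p := fun h => ‖U₀ h‖ = ‖h‖) h
      (isClosed_eq U₀.continuous.norm continuous_norm) fun f => ?_
    rw [hU₀, hKnorm]
  let U₁ : Lp ℂ 2 μ →ₗᵢ[ℂ] Lp ℂ 2 μ := ⟨U₀.toLinearMap, hiso⟩
  have hsymmU : ∀ h g, inner ℂ (conjLp μ (U₁ h)) g = inner ℂ (conjLp μ h) (U₁ g) := by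
    intro h g
    refine hdense.induction_on₂
      (p := fun h g => inner ℂ (conjLp μ (U₁ h)) g = inner ℂ (conjLp μ h) (U₁ g)) ?_ ?_ h g
    · refine isClosed_eq ?_ ?_
      · exact (((conjLp μ).continuous.comp U₁.continuous).comp continuous_fst).inner continuous_snd
      · exact ((conjLp μ).continuous.comp continuous_fst).inner (U₁.continuous.comp continuous_snd)
    · intro f g
      have h1 : U₁ (e f) = K f := hU₀ f
      have h2 : U₁ (e g) = K g := hU₀ g
      rw [h1, h2, inner_conjLp, inner_conjLp]
      calc _ = ∫ x, T f x * g x ∂μ := integral_congr_ae <| by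
            filter_upwards [hKae f, g.coeFn_toLp 2 μ] with x a b
            rw [a]
            exact congrArg _ b
        _ = ∫ x, f x * T g x ∂μ := hsymm f g (hmem f) (hmem g)
        _ = _ := integral_congr_ae <| by
            filter_upwards [hKae g, f.coeFn_toLp 2 μ] with x a b
            rw [a]
            exact congrArg (· * T g x) b.symm
  refine ⟨LinearIsometryEquiv.ofSurjective U₁ (U₁.surjective_of_inner_conjLp hsymmU),
    fun f => ?_, fun h g => ?_⟩
  · have h1 : U₁ (f.toLp 2 μ) = K f := hU₀ f
    rw [LinearIsometryEquiv.coe_ofSurjective, h1]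
    exact hKae f
  · rw [LinearIsometryEquiv.coe_ofSurjective]
    have h2 : U₁ (g.toLp 2 μ) = K g := hU₀ g
    have h3 := hsymmU h (g.toLp 2 μ)
    rw [h2, inner_conjLp, inner_conjLp] at h3
    calc _ = ∫ x, U₁ h x * g.toLp 2 μ x ∂μ := integral_congr_ae <| by
          filter_upwards [g.coeFn_toLp 2 μ] with x b
          rw [b]
      _ = _ := h3
      _ = _ := integral_congr_ae <| by
          filter_upwards [hKae g] with x a
          rw [a]

end SymmetricIsometry

/-! ### Symmetry of bounded kernels, and Plancherel with the normalized measure. -/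

section Kernels

/-- Integral operators with a bounded symmetric kernel are symmetric on integrable functions. -/
theorem integral_kernel_symm {X : Type*} [MeasurableSpace X] [TopologicalSpace X]
    [OpensMeasurableSpace (X × X)] {ν : Measure X} [SFinite ν]
    {e : X → X → ℂ} (he : Continuous fun p : X × X => e p.1 p.2) (hle : ∀ x y, ‖e x y‖ ≤ 1)
    (hsymm : ∀ x y, e x y = e y x) {f g : X → ℂ} (hf : Integrable f ν) (hg : Integrable g ν) :
    ∫ y, (∫ x, f x * e x y ∂ν) * g y ∂ν = ∫ x, f x * (∫ y, g y * e y x ∂ν) ∂ν := by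
  simp_rw [← integral_mul_const, ← integral_const_mul]
  rw [integral_integral_swap]
  · refine integral_congr_ae (Eventually.of_forall fun x => ?_)
    refine integral_congr_ae (Eventually.of_forall fun y => ?_)
    simp only
    rw [hsymm y x]
    ring
  · have h1 : Integrable (fun p : X × X => g p.1 * f p.2) (ν.prod ν) := hg.mul_prod hf
    refine (h1.bdd_mul (f := fun p : X × X => e p.2 p.1) (c := 1) ?_ ?_).congr ?_
    · exact (he.comp continuous_swap).aestronglyMeasurable
    · exact Eventually.of_forall fun p => hle _ _
    · exact Eventually.of_forall fun p => by simp [Function.uncurry]; ring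

/-- Plancherel for the exponent `±i⟨s, ξ⟩` follows from the one for `-2πi⟨s, ξ⟩` by rescaling ξ by
`-σ/(2π)`; the Jacobian `(2π)^d` cancels the square of the normalizing factor. Both signs are
needed: `σ = 1` for the partial transform, `σ = -1` for the full one. -/
theorem lintegral_enorm_sq_fourier {V : Type*} [NormedAddCommGroup V] [InnerProductSpace ℝ V]
    [FiniteDimensional ℝ V] [MeasurableSpace V] [BorelSpace V] (φ : 𝓢(V, ℂ)) {σ : ℝ}
    (hσ : |σ| = 1) :
    ∫⁻ ξ, ‖((2 * Real.pi) ^ (-(Module.finrank ℝ V : ℝ) / 2) : ℝ) •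
      ∫ s, φ s * Complex.exp (σ * Complex.I * (inner ℝ s ξ : ℝ))‖ₑ ^ 2 =
      ∫⁻ s, ‖φ s‖ₑ ^ 2 := by
  set d := Module.finrank ℝ V
  have hpi : (0 : ℝ) < 2 * Real.pi := by positivity
  have h1 : ∀ ξ : V, ∫ s, φ s * Complex.exp (σ * Complex.I * (inner ℝ s ξ : ℝ)) =
      FourierTransform.fourier φ ((-σ / (2 * Real.pi)) • ξ) := fun ξ => by
    rw [SchwartzMap.fourier_coe, Real.fourier_eq']
    refine integral_congr_ae (Eventually.of_forall fun s => ?_)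
    simp only [smul_eq_mul, inner_smul_right]
    rw [mul_comm]
    congr 2
    push_cast
    field_simp
  have h2 : ∀ ψ : 𝓢(V, ℂ), ∫⁻ s, ‖ψ s‖ₑ ^ 2 = ENNReal.ofReal (∫ s, ‖ψ s‖ ^ 2) := fun ψ => by
    rw [ofReal_integral_eq_lintegral_ofReal]
    · refine lintegral_congr fun s => ?_
      rw [ENNReal.ofReal_pow (norm_nonneg _), ofReal_norm]
    · have := (ψ.memLp 2 volume).integrable_norm_pow two_ne_zero
      simpa using this
    · exact Eventually.of_forall fun s => by positivity
  have h3 : ∀ ξ : V, ‖((2 * Real.pi) ^ (-(d : ℝ) / 2) : ℝ) •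
      ∫ s, φ s * Complex.exp (σ * Complex.I * (inner ℝ s ξ : ℝ))‖ₑ ^ 2 =
      ENNReal.ofReal ((2 * Real.pi) ^ d)⁻¹ *
        ‖FourierTransform.fourier φ ((-σ / (2 * Real.pi)) • ξ)‖ₑ ^ 2 := fun ξ => by
    rw [h1, enorm_smul, mul_pow, Real.enorm_eq_ofReal (by positivity),
      ← ENNReal.ofReal_pow (by positivity), ← Real.rpow_natCast, ← Real.rpow_mul hpi.le]
    congr 2
    rw [← Real.rpow_natCast, ← Real.rpow_neg hpi.le]
    congr 1
    push_cast
    ring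
  simp_rw [h3]
  rw [lintegral_const_mul' _ _ ENNReal.ofReal_ne_top]
  have hc : -σ / (2 * Real.pi) ≠ 0 := by
    have : σ ≠ 0 := by
      rintro rfl
      simp at hσ
    exact div_ne_zero (neg_ne_zero.2 this) hpi.ne'
  have h4 := (Measure.map_addHaar_smul (volume : Measure V) hc)
  have h5 : ∫⁻ ξ : V, ‖FourierTransform.fourier φ ((-σ / (2 * Real.pi)) • ξ)‖ₑ ^ 2 =
      ENNReal.ofReal ((2 * Real.pi) ^ d) * ∫⁻ ξ, ‖FourierTransform.fourier φ ξ‖ₑ ^ 2 := by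
    have h6 := lintegral_map (μ := (volume : Measure V))
      (f := fun ξ => ‖FourierTransform.fourier φ ξ‖ₑ ^ 2)
      (g := fun ξ : V => (-σ / (2 * Real.pi)) • ξ)
      ((FourierTransform.fourier φ).continuous.enorm.measurable.pow_const 2)
      (measurable_const_smul _)
    rw [← h6, h4, lintegral_smul_measure, smul_eq_mul]
    congr 2
    rw [abs_inv, abs_pow, abs_div, abs_neg, hσ, abs_of_pos hpi, one_div, inv_pow, inv_inv]
  rw [h5, ← mul_assoc, ← ENNReal.ofReal_mul (by positivity), inv_mul_cancel₀ (by positivity),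
    ENNReal.ofReal_one, one_mul, h2, h2]
  rw [SchwartzMap.integral_norm_sq_fourier]

end Kernels

/-! ### Partial and full Fourier transforms as unitary operators. -/

section PartialFourier

theorem integral_normLebesgue {G : Type*} [NormedAddCommGroup G] [NormedSpace ℝ G] {n : ℕ}
    (f : RSpace n → G) : ∫ s, f s ∂normLebesgue n =
      ((2 * Real.pi) ^ (-(n : ℝ) / 2) : ℝ) • ∫ s, f s := by
  rw [normLebesgue, integral_smul_measure, ENNReal.toReal_ofReal (by positivity)]

theorem normLebesgueProd_eq_smul_volume (m n : ℕ) : normLebesgueProd m n =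
    ENNReal.ofReal ((2 * Real.pi) ^ (-((m + n : ℕ) : ℝ) / 2)) • volume := by
  rw [normLebesgueProd, normLebesgue, normLebesgue, Measure.prod_smul_left,
    Measure.prod_smul_right, smul_smul, ← ENNReal.ofReal_mul (by positivity),
    ← Real.rpow_add (by positivity), ← Measure.volume_eq_prod]
  congr 3
  push_cast
  ring

theorem lintegral_enorm_sq_fourier_normLebesgue {n : ℕ} (φ : 𝓢(RSpace n, ℂ)) :
    ∫⁻ ξ, ‖∫ s, φ s * Complex.exp (Complex.I * (inner ℝ s ξ : ℝ)) ∂normLebesgue n‖ₑ ^ 2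
      ∂normLebesgue n = ∫⁻ s, ‖φ s‖ₑ ^ 2 ∂normLebesgue n := by
  have h := lintegral_enorm_sq_fourier φ (σ := 1) abs_one
  simp only [finrank_euclideanSpace, Fintype.card_fin, Complex.ofReal_one, one_mul] at h
  simp_rw [integral_normLebesgue]
  rw [normLebesgue, lintegral_smul_measure, lintegral_smul_measure, h]

/-- The Fourier transform in the first variable, `(ξ, t) ↦ ∫ f(s, t) e^{i⟨s, ξ⟩} ds`. -/
def partialFourier {m n : ℕ} (f : 𝓢(RSpace m × RSpace n, ℂ)) (p : RSpace m × RSpace n) : ℂ :=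
  ∫ s, f (s, p.2) * Complex.exp (Complex.I * (inner ℝ s p.1 : ℝ)) ∂normLebesgue m

/-- The Fourier transform in both variables. -/
def fullFourier {m n : ℕ} (f : 𝓢(RSpace m × RSpace n, ℂ)) (q : RSpace m × RSpace n) : ℂ :=
  ∫ z, f z * Complex.exp (-Complex.I * (inner ℝ z.1 q.1 + inner ℝ z.2 q.2 : ℝ))
    ∂normLebesgueProd m n

theorem SchwartzMap.exists_eq_slice {E F : Type*} [NormedAddCommGroup E] [NormedSpace ℝ E]
    [NormedAddCommGroup F] [NormedSpace ℝ F] (f : 𝓢(E × F, ℂ)) (t : F) :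
    ∃ φ : 𝓢(E, ℂ), ∀ s, φ s = f (s, t) := by
  have hg : (fun s : E => (s, t)).HasTemperateGrowth :=
    HasTemperateGrowth.pair Function.HasTemperateGrowth.id' (Function.HasTemperateGrowth.const t)
  refine ⟨SchwartzMap.compCLM ℂ hg ⟨1, 1, fun s => ?_⟩ f, fun s => rfl⟩
  have := norm_fst_le (s, t)
  simp only [pow_one, one_mul]
  linarith

theorem norm_exp_neg_I_mul (r : ℝ) : ‖Complex.exp (-Complex.I * (r : ℂ))‖ = 1 := by
  have := Complex.norm_exp_ofReal_mul_I (-r)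
  rwa [Complex.ofReal_neg, neg_mul, mul_comm, ← neg_mul] at this

theorem norm_exp_I_mul (r : ℝ) : ‖Complex.exp (Complex.I * (r : ℂ))‖ = 1 := by
  rw [mul_comm]
  exact Complex.norm_exp_ofReal_mul_I r

variable {m n : ℕ}

theorem SchwartzMap.exp_mul_integrable {E : Type*} [NormedAddCommGroup E] [NormedSpace ℝ E]
    [MeasurableSpace E] [BorelSpace E] [SecondCountableTopology E] {μ : Measure E}
    [μ.HasTemperateGrowth] (f : 𝓢(E, ℂ)) {θ : E → ℂ} (hθ : Continuous θ)
    (h1 : ∀ s, ‖θ s‖ = 1) : Integrable (fun s => f s * θ s) μ := by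
  refine (f.integrable.norm).mono' (f.continuous.mul hθ).aestronglyMeasurable
    (Eventually.of_forall fun s => ?_)
  rw [norm_mul, h1, mul_one]

theorem continuous_exp_inner (ξ : RSpace m) :
    Continuous fun s : RSpace m => Complex.exp (Complex.I * (inner ℝ s ξ : ℝ)) := by
  fun_prop

theorem partialFourier_integrand_integrable (f : 𝓢(RSpace m × RSpace n, ℂ))
    (p : RSpace m × RSpace n) : Integrable (fun s => f (s, p.2) *
      Complex.exp (Complex.I * (inner ℝ s p.1 : ℝ))) (normLebesgue m) := by
  obtain ⟨φ, hφ⟩ := f.exists_eq_slice p.2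
  simp_rw [← hφ]
  exact φ.exp_mul_integrable (continuous_exp_inner _) fun s => norm_exp_I_mul _

theorem fullFourier_integrand_integrable (f : 𝓢(RSpace m × RSpace n, ℂ))
    (q : RSpace m × RSpace n) : Integrable (fun z => f z *
      Complex.exp (-Complex.I * (inner ℝ z.1 q.1 + inner ℝ z.2 q.2 : ℝ)))
      (normLebesgueProd m n) :=
  f.exp_mul_integrable (by fun_prop) fun s => norm_exp_neg_I_mul _

theorem stronglyMeasurable_partialFourier (f : 𝓢(RSpace m × RSpace n, ℂ)) :
    StronglyMeasurable (partialFourier f) := by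
  have hc : Continuous fun r : (RSpace m × RSpace n) × RSpace m =>
      f (r.2, r.1.2) * Complex.exp (Complex.I * (inner ℝ r.2 r.1.1 : ℝ)) := by
    have := f.continuous
    fun_prop
  exact hc.stronglyMeasurable.integral_prod_right' (ν := normLebesgue m)

theorem stronglyMeasurable_fullFourier (f : 𝓢(RSpace m × RSpace n, ℂ)) :
    StronglyMeasurable (fullFourier f) := by
  have hc : Continuous fun r : (RSpace m × RSpace n) × (RSpace m × RSpace n) =>
      f r.2 * Complex.exp (-Complex.I * (inner ℝ r.2.1 r.1.1 + inner ℝ r.2.2 r.1.2 : ℝ)) := by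
    have := f.continuous
    fun_prop
  exact hc.stronglyMeasurable.integral_prod_right' (ν := normLebesgueProd m n)

/-- Tonelli with `t` frozen reduces this to Plancherel on each slice. -/
theorem lintegral_enorm_sq_partialFourier (f : 𝓢(RSpace m × RSpace n, ℂ)) :
    ∫⁻ p, ‖partialFourier f p‖ₑ ^ 2 ∂normLebesgueProd m n =
      ∫⁻ p, ‖f p‖ₑ ^ 2 ∂normLebesgueProd m n := by
  rw [lintegral_prod_symm _
    (((stronglyMeasurable_partialFourier f).enorm.pow_const 2).aemeasurable),
    lintegral_prod_symm _ ((f.continuous.enorm.measurable.pow_const 2).aemeasurable)]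
  refine lintegral_congr fun t => ?_
  obtain ⟨φ, hφ⟩ := f.exists_eq_slice t
  simp_rw [partialFourier, ← hφ]
  exact lintegral_enorm_sq_fourier_normLebesgue φ

/-- The product type carries the sup norm, so Plancherel is applied on the Hilbert space `WithLp 2`,
whose identification with the product preserves volume. -/
theorem lintegral_enorm_sq_fullFourier (f : 𝓢(RSpace m × RSpace n, ℂ)) :
    ∫⁻ p, ‖fullFourier f p‖ₑ ^ 2 ∂normLebesgueProd m n =
      ∫⁻ p, ‖f p‖ₑ ^ 2 ∂normLebesgueProd m n := by
  let V := WithLp 2 (RSpace m × RSpace n)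
  let φ : 𝓢(V, ℂ) := SchwartzMap.compCLMOfContinuousLinearEquiv ℂ
    (WithLp.prodContinuousLinearEquiv 2 ℝ (RSpace m) (RSpace n)) f
  have hφ : ∀ v : V, φ v = f (WithLp.ofLp v) := fun v => rfl
  have hmp : MeasurePreserving (fun v : V => WithLp.ofLp v) volume
      (volume : Measure (RSpace m × RSpace n)) :=
    WithLp.volume_preserving_ofLp _ _
  have hemb : MeasurableEmbedding (fun v : V => WithLp.ofLp v) :=
    (WithLp.prodContinuousLinearEquiv 2 ℝ (RSpace m)
      (RSpace n)).toHomeomorph.measurableEmbedding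
  have hd : Module.finrank ℝ V = m + n := by
    rw [(WithLp.linearEquiv 2 ℝ (RSpace m × RSpace n)).finrank_eq, Module.finrank_prod,
      finrank_euclideanSpace_fin, finrank_euclideanSpace_fin]
  have h := lintegral_enorm_sq_fourier φ (σ := -1) (by simp)
  rw [hd] at h
  rw [normLebesgueProd_eq_smul_volume, lintegral_smul_measure, lintegral_smul_measure]
  congr 1
  rw [← hmp.lintegral_comp_emb hemb, ← hmp.lintegral_comp_emb hemb]
  simp_rw [← hφ]
  rw [← h]
  refine lintegral_congr fun ξ => ?_
  congr 2
  rw [fullFourier, normLebesgueProd_eq_smul_volume, integral_smul_measure,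
    ENNReal.toReal_ofReal (by positivity), ← hmp.integral_comp hemb]
  congr 1
  refine integral_congr_ae (Eventually.of_forall fun s => ?_)
  have hin : inner ℝ s ξ = inner ℝ (WithLp.ofLp s).1 (WithLp.ofLp ξ).1 +
      inner ℝ (WithLp.ofLp s).2 (WithLp.ofLp ξ).2 := WithLp.prod_inner_apply s ξ
  simp [hφ, hin]

/-- `P` is described by its transpose because it will act on a general `L²` function, not a Schwartz
one, and the result is then paired with a Schwartz function. -/
theorem exists_partialFourier_unitary (m n : ℕ) :
    ∃ P : Lp ℂ 2 (normLebesgueProd m n) ≃ₗᵢ[ℂ] Lp ℂ 2 (normLebesgueProd m n),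
      ∀ (h : Lp ℂ 2 (normLebesgueProd m n)) (g : 𝓢(RSpace m × RSpace n, ℂ)),
        ∫ x, P h x * g x ∂normLebesgueProd m n =
          ∫ x, h x * partialFourier g x ∂normLebesgueProd m n := by
  have hadd : ∀ f g : 𝓢(RSpace m × RSpace n, ℂ), partialFourier (f + g) = partialFourier f + partialFourier g := by
    intro f g
    funext p
    simp only [partialFourier, add_apply, add_mul, Pi.add_apply]
    exact integral_add (partialFourier_integrand_integrable f p)
      (partialFourier_integrand_integrable g p)
  have hsmul : ∀ (c : ℂ) (f : 𝓢(RSpace m × RSpace n, ℂ)), partialFourier (c • f) = c • partialFourier f := by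
    intro c f
    funext p
    simp only [partialFourier, smul_apply, smul_eq_mul, Pi.smul_apply, mul_assoc]
    exact integral_const_mul c _
  have hsymm : ∀ f g : 𝓢(RSpace m × RSpace n, ℂ), MemLp (partialFourier f) 2 (normLebesgueProd m n) →
      MemLp (partialFourier g) 2 (normLebesgueProd m n) →
      ∫ x, partialFourier f x * g x ∂normLebesgueProd m n = ∫ x, f x * partialFourier g x ∂normLebesgueProd m n := by
    intro f g hf hg
    -- A product of two `L²` functions is integrable, so Fubini freezes `t` and the symmetry is
    -- checked on slices.
    have h1 : Integrable (fun x => partialFourier f x * g x) (normLebesgueProd m n) :=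
      hf.integrable_mul (g.memLp 2 _)
    have h2 : Integrable (fun x => f x * partialFourier g x) (normLebesgueProd m n) :=
      (f.memLp 2 _).integrable_mul hg
    rw [integral_prod_symm _ h1, integral_prod_symm _ h2]
    refine integral_congr_ae (Eventually.of_forall fun t => ?_)
    obtain ⟨φ, hφ⟩ := f.exists_eq_slice t
    obtain ⟨ψ, hψ⟩ := g.exists_eq_slice t
    simp only [partialFourier, ← hφ, ← hψ]
    exact integral_kernel_symm (e := fun s ξ : RSpace m =>
      Complex.exp (Complex.I * (inner ℝ s ξ : ℝ))) (by fun_prop)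
      (fun s ξ => (norm_exp_I_mul _).le) (fun s ξ => by rw [real_inner_comm])
      φ.integrable ψ.integrable
  obtain ⟨P, -, hP⟩ := exists_linearIsometryEquiv_of_symmetric (μ := normLebesgueProd m n)
    partialFourier hadd hsmul (fun f => (stronglyMeasurable_partialFourier f).aestronglyMeasurable)
    lintegral_enorm_sq_partialFourier hsymm
  exact ⟨P, hP⟩

theorem exists_fullFourier_unitary (m n : ℕ) :
    ∃ U : Lp ℂ 2 (normLebesgueProd m n) ≃ₗᵢ[ℂ] Lp ℂ 2 (normLebesgueProd m n),
      ∀ f : 𝓢(RSpace m × RSpace n, ℂ),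
        U (f.toLp 2 (normLebesgueProd m n)) =ᵐ[normLebesgueProd m n] fullFourier f := by
  have hadd : ∀ f g : 𝓢(RSpace m × RSpace n, ℂ), fullFourier (f + g) = fullFourier f + fullFourier g := by
    intro f g
    funext p
    simp only [fullFourier, add_apply, add_mul, Pi.add_apply]
    exact integral_add (fullFourier_integrand_integrable f p)
      (fullFourier_integrand_integrable g p)
  have hsmul : ∀ (c : ℂ) (f : 𝓢(RSpace m × RSpace n, ℂ)), fullFourier (c • f) = c • fullFourier f := by
    intro c f
    funext p
    simp only [fullFourier, smul_apply, smul_eq_mul, Pi.smul_apply, mul_assoc]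
    exact integral_const_mul c _
  have hsymm : ∀ f g : 𝓢(RSpace m × RSpace n, ℂ), MemLp (fullFourier f) 2 (normLebesgueProd m n) →
      MemLp (fullFourier g) 2 (normLebesgueProd m n) →
      ∫ x, fullFourier f x * g x ∂normLebesgueProd m n = ∫ x, f x * fullFourier g x ∂normLebesgueProd m n := by
    intro f g _ _
    exact integral_kernel_symm (e := fun z q : RSpace m × RSpace n =>
      Complex.exp (-Complex.I * (inner ℝ z.1 q.1 + inner ℝ z.2 q.2 : ℝ))) (by fun_prop)
      (fun z q => (norm_exp_neg_I_mul _).le)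
      (fun z q => by rw [real_inner_comm, real_inner_comm q.2])
      f.integrable g.integrable
  obtain ⟨U, hU, -⟩ := exists_linearIsometryEquiv_of_symmetric (μ := normLebesgueProd m n)
    fullFourier hadd hsmul (fun f => (stronglyMeasurable_fullFourier f).aestronglyMeasurable)
    lintegral_enorm_sq_fullFourier hsymm
  exact ⟨U, hU⟩

end PartialFourier

/-! ### Weighted composition operators between `L²` spaces. -/

section WeightedComposition

variable {α β : Type*} [MeasurableSpace α] [MeasurableSpace β] {μ : Measure α} {ν : Measure β}
  {φ : α → β} {a : α → ℂ}

/-- Composition with `φ` followed by multiplication with `a`, as an isometry between `L²` spaces. -/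
theorem exists_weighted_comp_isometry (hφ : Measure.QuasiMeasurePreserving φ μ ν)
    (ha : AEStronglyMeasurable a μ) (hG : ∀ G : β → ℝ≥0∞, Measurable G →
      ∫⁻ x, ‖a x‖ₑ ^ 2 * G (φ x) ∂μ = ∫⁻ y, G y ∂ν) :
    ∃ M : Lp ℂ 2 ν →ₗᵢ[ℂ] Lp ℂ 2 μ, ∀ g, M g =ᵐ[μ] fun x => a x * g (φ x) := by
  have hm : ∀ g : Lp ℂ 2 ν, AEStronglyMeasurable (fun x => a x * g (φ x)) μ := fun g =>
    ha.mul ((Lp.aestronglyMeasurable g).comp_quasiMeasurePreserving hφ)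
  have hn : ∀ g : Lp ℂ 2 ν, eLpNorm (fun x => a x * g (φ x)) 2 μ = eLpNorm g 2 ν := fun g => by
    rw [eLpNorm_two_eq, eLpNorm_two_eq,
      ← hG _ ((Lp.stronglyMeasurable g).enorm.pow_const 2)]
    simp_rw [enorm_mul, mul_pow]
  have hmem : ∀ g : Lp ℂ 2 ν, MemLp (fun x => a x * g (φ x)) 2 μ := fun g =>
    ⟨hm g, by rw [hn]; exact Lp.eLpNorm_lt_top g⟩
  let M₀ : Lp ℂ 2 ν →ₗ[ℂ] Lp ℂ 2 μ :=
    { toFun := fun g => (hmem g).toLp _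
      map_add' := fun g h => by
        rw [← MemLp.toLp_add]
        refine MemLp.toLp_congr _ _ ?_
        filter_upwards [hφ.ae_eq_comp (Lp.coeFn_add g h)] with x hx
        simp only [Function.comp_apply, Pi.add_apply] at hx ⊢
        rw [hx, mul_add]
      map_smul' := fun c g => by
        rw [RingHom.id_apply, ← MemLp.toLp_const_smul]
        refine MemLp.toLp_congr _ _ ?_
        filter_upwards [hφ.ae_eq_comp (Lp.coeFn_smul c g)] with x hx
        simp only [Function.comp_apply, Pi.smul_apply, smul_eq_mul] at hx ⊢
        rw [hx]
        ring }
  refine ⟨⟨M₀, fun g => ?_⟩, fun g => (hmem g).coeFn_toLp⟩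
  change ‖(hmem g).toLp _‖ = ‖g‖
  rw [Lp.norm_toLp, hn, Lp.norm_def]

/-- The equation to solve is `g(φ x) = h(x) / a(x)`. A measurable injective map on a standard Borel
set is a measurable embedding, so `h / a` descends to the image and extends to a measurable `g`;
`hG` then gives `g` the `L²` norm of `h`. The values of `g` off the image are immaterial. -/
theorem surjective_of_weighted_comp [StandardBorelSpace α] [StandardBorelSpace β]
    (hφ : Measure.QuasiMeasurePreserving φ μ ν) (ha : AEStronglyMeasurable a μ) (hG : ∀ G : β → ℝ≥0∞, Measurable G →
      ∫⁻ x, ‖a x‖ₑ ^ 2 * G (φ x) ∂μ = ∫⁻ y, G y ∂ν)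
    (ha0 : ∀ᵐ x ∂μ, a x ≠ 0) {S : Set α} (hS : MeasurableSet S) (hSμ : ∀ᵐ x ∂μ, x ∈ S)
    (hinj : Set.InjOn φ S) (h : Lp ℂ 2 μ) :
    ∃ g : Lp ℂ 2 ν, ∀ᵐ x ∂μ, a x * g (φ x) = h x := by
  have hw : AEStronglyMeasurable (fun x => h x / a x) μ :=
    ((Lp.aestronglyMeasurable h).aemeasurable.div ha.aemeasurable).aestronglyMeasurable
  obtain ⟨w, hwm, hwe⟩ := hw
  have : StandardBorelSpace S := hS.standardBorel
  have hemb : MeasurableEmbedding (S.domRestrict φ) :=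
    (hφ.measurable.comp measurable_subtype_coe).measurableEmbedding (Set.injOn_iff_injective.1 hinj)
  obtain ⟨g, hgm, hg⟩ := hemb.exists_measurable_extend
    (hwm.measurable.comp measurable_subtype_coe) fun _ => ⟨0⟩
  have hg' : ∀ x ∈ S, g (φ x) = w x := fun x hx => congrFun hg ⟨x, hx⟩
  have key : ∀ᵐ x ∂μ, a x * g (φ x) = h x := by
    filter_upwards [hwe, hSμ, ha0] with x h1 h2 h3
    rw [hg' x h2, ← h1, mul_div_cancel₀ _ h3]
  have hn : eLpNorm g 2 ν = eLpNorm h 2 μ := by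
    rw [eLpNorm_two_eq, eLpNorm_two_eq, ← hG _ (hgm.enorm.pow_const 2)]
    congr 1
    refine lintegral_congr_ae ?_
    filter_upwards [key] with x hx
    rw [← hx, enorm_mul, mul_pow]
  have hmem : MemLp g 2 ν := ⟨hgm.aestronglyMeasurable, by rw [hn]; exact Lp.eLpNorm_lt_top h⟩
  refine ⟨hmem.toLp g, ?_⟩
  filter_upwards [key, hφ.ae_eq_comp hmem.coeFn_toLp] with x h1 h2
  simp only [Function.comp_apply] at h2
  rw [h2, h1]

end WeightedComposition

/-! ### Isometries with a kernel are generalized Fourier transforms. -/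

section Kernel

theorem inner_conjLp_conjLp {X : Type*} [MeasurableSpace X] {μ : Measure X} (h g : Lp ℂ 2 μ) :
    inner ℂ (conjLp μ h) (conjLp μ g) = conj (inner ℂ h g) := by
  rw [inner_conjLp, inner_conj_symm, L2.inner_def]
  refine integral_congr_ae ?_
  filter_upwards [coeFn_conjLp g] with x hx
  rw [hx, RCLike.inner_apply]

variable {X : Type*} [NormedAddCommGroup X] [NormedSpace ℝ X] [MeasurableSpace X] [BorelSpace X]
  {μ : Measure X} [μ.HasTemperateGrowth]

theorem SchwartzMap.toLp_conjugate (f : 𝓢(X, ℂ)) :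
    f.conjugate.toLp 2 μ = conjLp μ (f.toLp 2 μ) := by
  refine Lp.ext ?_
  filter_upwards [f.conjugate.coeFn_toLp 2 μ, f.coeFn_toLp 2 μ, coeFn_conjLp (f.toLp 2 μ)]
    with x h1 h2 h3
  rw [h1, h3, h2, SchwartzMap.conjugate_apply]

theorem integral_mul_schwartz (h : Lp ℂ 2 μ) (ψ : 𝓢(X, ℂ)) :
    ∫ x, h x * ψ x ∂μ = inner ℂ (conjLp μ h) (ψ.toLp 2 μ) := by
  rw [inner_conjLp]
  refine integral_congr_ae ?_
  filter_upwards [ψ.coeFn_toLp 2 μ] with x hx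
  rw [hx]

variable {Y : Type*} [NormedAddCommGroup Y] [NormedSpace ℝ Y]
  [MeasurableSpace Y] [BorelSpace Y] {ν : Measure Y}
  [ν.HasTemperateGrowth]

/-- The adjoint of an operator with kernel `e(x, y)` has the kernel `conj (e(x, y))`. -/
theorem HasKernel.adjoint {e : 𝓢'(X × Y, ℂ)} {F : Lp ℂ 2 μ →L[ℂ] Lp ℂ 2 ν}
    (hF : HasKernel F e) : HasKernel (ContinuousLinearMap.adjoint F) (adjointKernel e) := by
  intro f ψ
  -- Conjugating and swapping a tensor product gives the tensor product of the conjugates, on which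
  -- the hypothesis about `F` can be evaluated.
  have h1 : SchwartzMap.compCLMOfContinuousLinearEquiv ℂ
      (ContinuousLinearEquiv.prodComm ℝ X Y) (f.tensor ψ).conjugate =
      ψ.conjugate.tensor f.conjugate := by
    ext ⟨x, y⟩
    simp only [SchwartzMap.compCLMOfContinuousLinearEquiv_apply, Function.comp_apply,
      SchwartzMap.conjugate_apply, SchwartzMap.tensor_apply,
      ContinuousLinearEquiv.prodComm_apply, Prod.swap_prod_mk, map_mul]
    rw [mul_comm]
  rw [adjointKernel, h1, ← hF, integral_mul_schwartz, integral_mul_schwartz,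
    SchwartzMap.toLp_conjugate, SchwartzMap.toLp_conjugate, inner_conjLp_conjLp,
    Complex.conj_conj]
  nth_rw 1 [← conjLp_conjLp (ψ.toLp 2 μ)]
  rw [inner_conjLp_conjLp, ContinuousLinearMap.adjoint_inner_left, inner_conj_symm]

/-- Plancherel is preservation of inner products. Since `F* F = 1`, the adjoint is the required left
inverse, and `HasKernel.adjoint` identifies its kernel. -/
theorem LinearIsometry.isGeneralizedFourierTransform {e : 𝓢'(X × Y, ℂ)}
    (F : Lp ℂ 2 μ →ₗᵢ[ℂ] Lp ℂ 2 ν) (hF : HasKernel F.toContinuousLinearMap e) :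
    IsGeneralizedFourierTransform e F.toContinuousLinearMap where
  hasKernel := hF
  plancherel f g := by
    have h := F.inner_map_map g f
    rw [L2.inner_def, L2.inner_def] at h
    simp only [RCLike.inner_apply] at h
    exact h.symm
  inversion := by
    refine ⟨_, hF.adjoint, fun f => ext_inner_right ℂ fun g => ?_⟩
    rw [ContinuousLinearMap.adjoint_inner_left]
    exact F.inner_map_map f g

end Kernel

/-! ### The slice identity for the plane transform. -/

section PlaneTransform

variable {k l : ℕ} (u : Matrix (Fin l) (Fin k) (MvPolynomial (Fin k) ℝ))

theorem inner_mulCol (t x : RSpace k) (ξ : RSpace l) :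
    inner ℝ (mulCol u t x) ξ = inner ℝ x (rowMul u ξ t) := by
  simp only [EuclideanSpace.inner_eq_star_dotProduct, mulCol, rowMul, star_trivial]
  rw [Matrix.dotProduct_mulVec, dotProduct_comm]

/-- Justifies Fubini in the slice identity: the shear `(z, s) ↦ (z, y - u(t)x - s)`, with `z = (x,
y)`, preserves measure and carries the integrand, up to a unimodular factor, to a product of two
integrable functions. -/
theorem integrable_planeTest_integrand (f : 𝓢(RSpace k × RSpace l, ℂ))
    (ψ : 𝓢(RSpace l × RSpace k, ℂ)) (ξ : RSpace l) (t : RSpace k) :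
    Integrable (fun r : RSpace l × (RSpace k × RSpace l) =>
      f r.2 * ψ (r.2.2 - mulCol u t r.2.1 - r.1, t) *
        Complex.exp (-Complex.I * (inner ℝ r.1 ξ : ℝ)))
      ((normLebesgue l).prod (normLebesgueProd k l)) := by
  obtain ⟨φ, hφ⟩ := ψ.exists_eq_slice t
  have hc : Continuous fun z : RSpace k × RSpace l => z.2 - mulCol u t z.1 :=
    continuous_snd.sub (hasTemperateGrowth_mulCol u (Function.HasTemperateGrowth.const t)
      (ContinuousLinearMap.fst ℝ (RSpace k) (RSpace l)).hasTemperateGrowth).1.continuous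
  have hmp : MeasurePreserving (fun r : (RSpace k × RSpace l) × RSpace l =>
      (r.1, r.1.2 - mulCol u t r.1.1 - r.2)) ((normLebesgueProd k l).prod (normLebesgue l))
      ((normLebesgueProd k l).prod (normLebesgue l)) := by
    refine MeasurePreserving.skew_product (f := id)
      (g := fun (z : RSpace k × RSpace l) s => z.2 - mulCol u t z.1 - s) (MeasurePreserving.id _) ?_ ?_
    · exact ((hc.comp continuous_fst).sub continuous_snd).measurable
    · exact Eventually.of_forall fun z => (Measure.measurePreserving_sub_left _ _).map_eq
  have h1 : Integrable (fun r : (RSpace k × RSpace l) × RSpace l => f r.1 * φ r.2)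
      ((normLebesgueProd k l).prod (normLebesgue l)) := f.integrable.mul_prod φ.integrable
  have h2 := (hmp.integrable_comp_of_integrable h1).swap
  refine (h2.bdd_mul (f := fun r : RSpace l × (RSpace k × RSpace l) =>
    Complex.exp (-Complex.I * (inner ℝ r.1 ξ : ℝ))) (c := 1) ?_ ?_).congr ?_
  · exact Continuous.aestronglyMeasurable (by fun_prop)
  · exact Eventually.of_forall fun r => (norm_exp_neg_I_mul _).le
  · refine Eventually.of_forall fun r => ?_
    simp only [Function.comp_apply, Prod.swap, hφ]
    ring

/-- With `c = y - u(t)x`, the substitution `s ↦ c - s` factors the exponential as `e^{-i⟨c, ξ⟩}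
e^{i⟨s, ξ⟩}`. Moving `u(t)` across the inner product gives `⟨c, ξ⟩ = ⟨x, -ξu(t)⟩ + ⟨y, ξ⟩`, which is
where the point `(-ξu(t), ξ)` comes from. -/
theorem integral_planeTest_tensor (f : 𝓢(RSpace k × RSpace l, ℂ))
    (ψ : 𝓢(RSpace l × RSpace k, ℂ)) (ξ : RSpace l) (t : RSpace k) :
    ∫ s, planeTest u (f.tensor ψ) (s, t) * Complex.exp (-Complex.I * (inner ℝ s ξ : ℝ))
      ∂normLebesgue l = fullFourier f (-rowMul u ξ t, ξ) * partialFourier ψ (ξ, t) := by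
  simp_rw [planeTest_apply, SchwartzMap.tensor_apply, ← integral_mul_const]
  rw [integral_integral_swap (integrable_planeTest_integrand u f ψ ξ t), fullFourier,
    ← integral_mul_const]
  refine integral_congr_ae (Eventually.of_forall fun z => ?_)
  set c := z.2 - mulCol u t z.1 with hc
  have h1 : inner ℝ z.1 (-rowMul u ξ t) + inner ℝ z.2 ξ = inner ℝ c ξ := by
    rw [hc, inner_sub_left, inner_mulCol, inner_neg_right]
    ring
  simp only [h1, mul_assoc]
  rw [integral_const_mul]
  congr 1
  rw [← integral_sub_left_eq_self _ _ c, partialFourier, ← integral_const_mul]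
  refine integral_congr_ae (Eventually.of_forall fun s => ?_)
  simp only [← hc, sub_sub_cancel, inner_sub_left]
  rw [mul_left_comm, ← Complex.exp_add]
  congr 2
  push_cast
  ring

end PlaneTransform

end

/-! ### Assembly of the factorization, and surjectivity. -/

theorem mainTheorem6 {k l : ℕ} (hk : 0 < k) (hl : 1 < l)
    (u : Matrix (Fin l) (Fin k) (MvPolynomial (Fin k) ℝ))
    (hCr : ∀ᵐ p : RSpace k × RSpace l ∂normLebesgueProd k l,
      croftonFunction u p.1 p.2 ≠ 0 ∧ croftonFunction u p.1 p.2 ≠ ⊤)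
    (a : 𝓢'(RSpace l × RSpace k, ℂ)) (a' : RSpace l × RSpace k → ℂ)
    (ha : HasPartialFourierTransform a a')
    (ha' : ∀ᵐ p : RSpace l × RSpace k ∂normLebesgueProd l k,
      ‖a' p‖ = ((croftonFunction u (-rowMul u p.1 p.2) p.1).toNat : ℝ) ^ (-(1 / 2) : ℝ) *
        |jacobian u p.1 p.2| ^ (1 / 2 : ℝ)) :
    ∃ F : Lp ℂ 2 (normLebesgueProd k l) →L[ℂ] Lp ℂ 2 (normLebesgueProd l k),
      IsGeneralizedFourierTransform (planeKernel u a) F ∧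
      ((∀ᵐ p : RSpace k × RSpace l ∂normLebesgueProd k l, croftonFunction u p.1 p.2 = 1) →
        Function.Surjective F) := by
  obtain ⟨P, hP⟩ := exists_partialFourier_unitary l k
  obtain ⟨U, hU⟩ := exists_fullFourier_unitary k l
  have hφ := quasiMeasurePreserving_rowMul hCr
  have ham := ha.locallyIntegrable.aestronglyMeasurable
  have hG : ∀ G : RSpace k × RSpace l → ℝ≥0∞, Measurable G → _ :=
    fun G hG => lintegral_enorm_sq_mul_comp_rowMul hCr ha' hG
  obtain ⟨M, hM⟩ := exists_weighted_comp_isometry hφ ham hG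
  let F : Lp ℂ 2 (normLebesgueProd k l) →ₗᵢ[ℂ] Lp ℂ 2 (normLebesgueProd l k) :=
    P.toLinearIsometry.comp (M.comp U.toLinearIsometry)
  have hF : ∀ f, F f = P (M (U f)) := fun f => rfl
  refine ⟨F.toContinuousLinearMap, F.isGeneralizedFourierTransform fun f ψ => ?_, fun h1 h => ?_⟩
  · rw [planeKernel_apply, ha.apply_eq]
    simp_rw [integral_planeTest_tensor]
    refine (hP _ ψ).trans (integral_congr_ae ?_)
    -- `U f` agrees with the pointwise Fourier integral only almost everywhere; quasi-preservation
    -- of measure keeps this true after composing with `φ`.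
    filter_upwards [hM (U (f.toLp 2 (normLebesgueProd k l))), hφ.ae_eq_comp (hU f)] with p h1 h2
    simp only [Function.comp_apply] at h2
    rw [← mul_assoc, ← h2]
    exact congrArg (· * partialFourier ψ p) h1
  -- `s` is a Borel null set containing all points where the Crofton function differs from 1. Over
  -- its complement each fibre of `φ` is a single point, and the preimage of that complement has
  -- full measure.
  · obtain ⟨s, hs, hsm, hs0⟩ := exists_measurable_superset_of_null (ae_iff.1 h1)
    have hS : MeasurableSet ((fun p : RSpace l × RSpace k => (-rowMul u p.1 p.2, p.1)) ⁻¹' sᶜ) :=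
      hφ.measurable hsm.compl
    have hinj : Set.InjOn (fun p : RSpace l × RSpace k => (-rowMul u p.1 p.2, p.1))
        ((fun p : RSpace l × RSpace k => (-rowMul u p.1 p.2, p.1)) ⁻¹' sᶜ) := by
      rintro ⟨ξ, t⟩ hp ⟨ξ', t'⟩ - hpp
      obtain ⟨h2, rfl⟩ := Prod.ext_iff.1 hpp
      have h3 : croftonFunction u (-rowMul u ξ t) ξ = 1 := by
        by_contra h0
        exact hp (hs h0)
      have h4 := Set.encard_le_one_iff.1 h3.le t t' rfl h2
      rw [h4]
    obtain ⟨g, hg⟩ := surjective_of_weighted_comp hφ ham hG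
      (ae_ne_zero_of_norm_eq hCr ha') hS (hφ.ae (measure_eq_zero_iff_ae_notMem.1 hs0)) hinj
      (P.symm h)
    refine ⟨U.symm g, ?_⟩
    change P (M (U (U.symm g))) = h
    rw [U.apply_symm_apply]
    have : M g = P.symm h := Lp.ext ((hM g).trans hg)
    rw [this, P.apply_symm_apply]
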